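/- Let $f(x)=\ln(1+|x|)$, applied entrywise to matrices. Let $A\in\mathbb R^{n\times d}$ with $d\ge 1$ be such that $f(A)$ has full column rank, let $b\in\mathbb R^n$ and $\epsilon,\delta\in(0,1)$. Write $Q=(f(A)\;\;b)\in\mathbb R^{n\times(d+1)}$, $p_u=\|Q_u\|_2^2/\|Q\|_F^2$ for the squared-norm sampling probability of row $u$, and $\kappa=\sigma_1(f(A))/\sigma_d(f(A))$ for the condition number. *Algorithm.* The matrix $(A\;\;b)$ is given as a turnstile stream and is read in one pass by $s$ parallel instances of an $H$-Sketch: hash tables that hold, at each of the subsampling rates $2^{-\ell}$, $0\le \ell\le\lceil\log_2 n\rceil$, and for several repetitions, randomly signed sums of the rows in each bucket. From its tables (and an estimate $\widehat M$ of $\|Q\|_F^2$ that is part of the input of the sampling procedure) instance $t$ picks first a magnitude level and then a row index $u_t$, and returns a noisy copy $h_t\in\mathbb R^{d+1}$ of $Q_{u_t}$ and a sampling probability $\hat p_t$. Let $T$ be the matrix with rows $h_t/\sqrt{s\hat p_t}$, $\tilde M$ its first $d$ columns and $\tilde b$ its last column; the output is a minimizer $\tilde x$ of $\|\tilde Mx-\tilde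 b\|_2$. *Standing assumption on the samples (with a parameter $\gamma\epsilon$).* The indices $u_1,\dots,u_s$ are independent with $\Pr\{u_t=u\}\le(1+\gamma\epsilon)p_u$ for all $u$ (for instance $\Pr\{u_t=u\}=p_u$), and almost surely every sample is good: $|\hat p_t-p_{u_t}|\le\gamma\epsilon\,p_{u_t}$ and $\|h_t-Q_{u_t}\|_2\le\gamma\epsilon\|Q_{u_t}\|_2$. **Theorem.** There are absolute constants $\gamma,C>0$ such that the following holds with $s=\left\lceil C\,\frac{d\kappa^2}{\epsilon^2}\log\frac d\delta\right\rceil$. 1. For any noisy row samples $(u_t,h_t,\hat p_t)_{t\le s}$ that satisfy the standing assumption, and in particular for those that the streaming algorithm extracts from its sketch whenever they satisfy it, with probability at least $1-\delta$ a minimizer $\tilde x$ exists and every such $\tilde x$ satisfies $$\|\tilde M\tilde x-\tilde b\|_2\le(1+\epsilon)\min_{x\in\mathbb R^d}\|f(A)x-b\|_2+\Delta,$$ $$\Delta=\epsilon\left(\sqrt{d+\frac{\|b\|_2^2}{\|f(A)\|_2^2}}\;\kappa\|b\|_2+\sqrt{\|f(A)\|_F^2+\|b\|_2^2}\right).$$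 2. The total space of the algorithm, in words (hash tables, hash seeds, working lists, $T$ and $\tilde x$; the production of the estimate $\widehat M$ is not counted), is $\tilde O\!\left(d^2\kappa^2\log\frac1\delta\right)\cdot\mathrm{poly}(\log n,\frac1\epsilon)$. That is, for every choice of the constants in the sizes of the sketch there are $B>0$ and $a\in\mathbb N$ such that, with $X=d^2\kappa^2\max\{1,\log\frac1\delta\}$, the space is at most $B\,X\,\log^a(2+X)\,\bigl(\log(2+n)/\epsilon\bigr)^a$ for all $n,d,A,b,\epsilon,\delta$ as above. -/

import Mathlib

open MeasureTheory ProbabilityTheory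

universe u

namespace RegSketch

noncomputable section

/-! ### Linear algebra -/

/-- The transformation `f(x) = ln(1 + |x|)`. -/
def logAbs (x : ℝ) : ℝ := Real.log (1 + |x|)

/-- The entrywise transformed matrix `f(A)`. -/
def logMatrix {n d : ℕ} (A : Matrix (Fin n) (Fin d) ℝ) : Matrix (Fin n) (Fin d) ℝ :=
  A.map logAbs

/-- The Euclidean norm of a vector. -/
def l2norm {ι : Type*} [Fintype ι] (v : ι → ℝ) : ℝ := ‖WithLp.toLp 2 v‖

/-- The Frobenius norm `‖M‖_F`. -/
def frobNorm {n d : ℕ} (M : Matrix (Fin n) (Fin d) ℝ) : ℝ :=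
  Real.sqrt (∑ i, ∑ j, M i j ^ 2)

/-- The operator norm `‖M‖₂` with respect to the Euclidean norms. -/
def specNorm {n d : ℕ} (M : Matrix (Fin n) (Fin d) ℝ) : ℝ :=
  ‖(Matrix.toEuclideanLin M).toContinuousLinearMap‖

/-- The condition number `σ₁ / σ_d` of a matrix with `d` columns
(Mathlib numbers the singular values from `0`). -/
def condNumber {n d : ℕ} (M : Matrix (Fin n) (Fin d) ℝ) : ℝ :=
  (Matrix.toEuclideanLin M).singularValues 0 / (Matrix.toEuclideanLin M).singularValues (d - 1)

/-- The concatenated matrix `(M  b)`; the last column is `b`. -/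
def augment {n d : ℕ} (M : Matrix (Fin n) (Fin d) ℝ) (b : Fin n → ℝ) :
    Matrix (Fin n) (Fin (d + 1)) ℝ :=
  Matrix.of fun i => Fin.snoc (α := fun _ => ℝ) (M i) (b i)

/-- The map `g` on `ℝ^(d+1)`: apply `f` to the first `d` coordinates, keep the last one. -/
def transformRow {d : ℕ} (x : Fin (d + 1) → ℝ) : Fin (d + 1) → ℝ :=
  Fin.snoc (α := fun _ => ℝ) (fun k : Fin d => logAbs (x k.castSucc)) (x (Fin.last d))

/-! ### Noisy row samples and the regression step -/

/-- What one sampling instance returns: the position of the sampled row, a noisy copy of the row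
of `(f(A)  b)` at that position, and the returned sampling probability. -/
structure RowSample (n d : ℕ) where
  index : Fin n
  row : Fin (d + 1) → ℝ
  prob : ℝ

/-- The squared-norm sampling probability `p_u = ‖Q_u‖² / ‖Q‖_F²` of row `u`. -/
def rowProb {n m : ℕ} (Q : Matrix (Fin n) (Fin m) ℝ) (u : Fin n) : ℝ :=
  l2norm (Q u) ^ 2 / frobNorm Q ^ 2

/-- A sample is `γ`-good for `Q`: the returned probability is a `(1 ± γ)`-approximation of the
true one, and the noise is at most a `γ`-fraction of the row in Euclidean norm. -/
def IsGoodSample {n d : ℕ} (γ : ℝ) (Q : Matrix (Fin n) (Fin (d + 1)) ℝ) (h : RowSample n d) :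
    Prop :=
  |h.prob - rowProb Q h.index| ≤ γ * rowProb Q h.index ∧
    l2norm (fun k => h.row k - Q h.index k) ≤ γ * l2norm (Q h.index)

/-- The standing assumption on the `s` samples: the sampled positions are independent, they follow
the squared-norm distribution of `Q` up to a factor `1 + γ` (only the upper estimate is required,
so that rows of tiny norm may be missed; sampling with probability exactly `p_u`, or `(1 ± γ) p_u`,
is a special case), and every sample is `γ`-good.  Nothing is assumed on how the noise and the
returned probabilities depend on the positions. -/
structure GoodSampling {n d s : ℕ} {Ω : Type u} [MeasurableSpace Ω] (μ : Measure Ω) (γ : ℝ)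
    (Q : Matrix (Fin n) (Fin (d + 1)) ℝ) (h : Fin s → Ω → RowSample n d) : Prop where
  measurable_index : ∀ t, Measurable fun ω => (h t ω).index
  indep : iIndepFun (fun t ω => (h t ω).index) μ
  law : ∀ t v, μ {ω | (h t ω).index = v} ≤ ENNReal.ofReal ((1 + γ) * rowProb Q v)
  good : ∀ᵐ ω ∂μ, ∀ t, IsGoodSample γ Q (h t ω)

/-- The matrix `T` with rows `h_t / √(s p̂_t)`. -/
def sampleMatrix {n d s : ℕ} (h : Fin s → RowSample n d) : Matrix (Fin s) (Fin (d + 1)) ℝ :=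
  Matrix.of fun t k => (h t).row k / Real.sqrt (s * (h t).prob)

/-- `M̃`: the first `d` columns of `T`. -/
def sketchMatrix {n d s : ℕ} (h : Fin s → RowSample n d) : Matrix (Fin s) (Fin d) ℝ :=
  Matrix.of fun t k => sampleMatrix h t k.castSucc

/-- `b̃`: the last column of `T`. -/
def sketchVector {n d s : ℕ} (h : Fin s → RowSample n d) : Fin s → ℝ :=
  fun t => sampleMatrix h t (Fin.last d)

/-- The regression cost `‖M x - b‖₂`. -/
def cost {n d : ℕ} (M : Matrix (Fin n) (Fin d) ℝ) (b : Fin n → ℝ) (x : Fin d → ℝ) : ℝ :=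
  l2norm (M.mulVec x - b)

/-- `x̃` is an output of the algorithm on the given samples: it minimizes `‖M̃ x - b̃‖₂`. -/
def IsOutput {n d s : ℕ} (h : Fin s → RowSample n d) (x : Fin d → ℝ) : Prop :=
  IsMinOn (cost (sketchMatrix h) (sketchVector h)) Set.univ x

/-- The additive error `Δ`. -/
def additiveError {n d : ℕ} (A : Matrix (Fin n) (Fin d) ℝ) (b : Fin n → ℝ) (ε : ℝ) : ℝ :=
  ε * (Real.sqrt (d + l2norm b ^ 2 / specNorm (logMatrix A) ^ 2) * condNumber (logMatrix A)
        * l2norm b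
      + Real.sqrt (frobNorm (logMatrix A) ^ 2 + l2norm b ^ 2))

/-- An output exists, and every output `x̃` satisfies
`‖M̃ x̃ - b̃‖₂ ≤ (1 + ε) min_x ‖f(A) x - b‖₂ + Δ`. -/
def RegressionGuarantee {n d s : ℕ} (A : Matrix (Fin n) (Fin d) ℝ) (b : Fin n → ℝ) (ε : ℝ)
    (h : Fin s → RowSample n d) : Prop :=
  (∃ x, IsOutput h x) ∧
    ∀ x, IsOutput h x →
      cost (sketchMatrix h) (sketchVector h) x ≤
        (1 + ε) * (⨅ y, cost (logMatrix A) b y) + additiveError A b ε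

/-! ### The streaming sketch

All logarithms that fix sizes are to base `2`. -/

/-- The absolute constants behind the `O(1)`, `O(·)` and `Θ(·)` in the sizes of the sketch:
`nu`, `phi` for the two parameters of a heavy hitter structure, `width` for the number of buckets,
`rep` for the number of repetitions, `top` for the number of heavy hitters that are kept,
`K` for the accuracy of the estimate `M̂` of `‖(f(A)  b)‖_F²`, and `acc` for the rescaling of
the accuracy: the sketch runs with accuracy `acc * ε`. -/
structure SketchConst where
  nu : ℝ
  phi : ℝ
  width : ℝ
  rep : ℝ
  top : ℝ
  K : ℝ
  acc : ℝ
  nu_pos : 0 < nu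
  phi_pos : 0 < phi
  width_pos : 0 < width
  rep_pos : 0 < rep
  top_pos : 0 < top
  one_le_K : 1 ≤ K
  acc_pos : 0 < acc
  acc_le_one : acc ≤ 1

/-- The sizes of one sampling instance: its accuracy `η`, the number `L` of magnitude levels, the
last level `j₀` that is handled without subsampling, the number `L̂` of subsampling rates, the
exponents of the numbers of buckets (a power of two) of `𝓓₀` and of `𝓓₁, …, 𝓓_L̂`, the
number of repetitions in a heavy hitter structure, and the number of heavy hitters kept. -/
structure SketchSize where
  eta : ℝ
  levels : ℕ
  directLevels : ℕ
  rates : ℕ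
  logWidthZero : ℕ
  logWidthSub : ℕ
  reps : ℕ
  reps_pos : 0 < reps
  top : ℕ

/-- `⌈log₂ (width / (φ² ν³))⌉`: a heavy hitter structure with parameters `ν`, `φ` uses
`O(1 / (φ² ν³))` buckets. -/
def logBuckets (c : SketchConst) (φ : ℝ) : ℕ :=
  Nat.clog 2 ⌈c.width / (φ ^ 2 * c.nu ^ 3)⌉₊

/-- The sizes of each of `s` parallel instances on `n` rows with target accuracy `ε`.  Here
`η = acc * ε`, `L = log(K n / η)`, `L̂ = log n`, `j₀ = log(4 K L³ / η³)`; the heavy hitter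
structure `𝓓₀` has `φ = O(η³ / (K L³))`, the structures `𝓓_ℓ`, `ℓ ≥ 1`, have
`φ = O(η³ / L³)`; all have `O(log(n / δ'))` repetitions with failure probability
`δ' = 1 / ((L̂ + 1) s)`, the factor `s` being what lets all `s` samples be good at once; and
`Θ(L³ / η³)` heavy hitters are kept at each rate. -/
def SketchConst.size (c : SketchConst) (n s : ℕ) (ε : ℝ) : SketchSize where
  eta := c.acc * ε
  levels := ⌈Real.logb 2 (c.K * n / (c.acc * ε))⌉₊
  directLevels :=
    ⌈Real.logb 2 (4 * c.K * (⌈Real.logb 2 (c.K * n / (c.acc * ε))⌉₊ : ℝ) ^ 3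
      / (c.acc * ε) ^ 3)⌉₊
  rates := Nat.clog 2 n
  logWidthZero := logBuckets c
    (c.phi * (c.acc * ε) ^ 3
      / (c.K * (⌈Real.logb 2 (c.K * n / (c.acc * ε))⌉₊ : ℝ) ^ 3))
  logWidthSub := logBuckets c
    (c.phi * (c.acc * ε) ^ 3 / (⌈Real.logb 2 (c.K * n / (c.acc * ε))⌉₊ : ℝ) ^ 3)
  reps := ⌈c.rep * Real.logb 2 (n * ((Nat.clog 2 n + 1) * s))⌉₊ + 1
  reps_pos := Nat.succ_pos _
  top := ⌈c.top * (⌈Real.logb 2 (c.K * n / (c.acc * ε))⌉₊ : ℝ) ^ 3 / (c.acc * ε) ^ 3⌉₊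

namespace SketchSize

/-- The exponent of the number of buckets at subsampling rate `2^(-ℓ)`. -/
def logWidth (P : SketchSize) (ℓ : ℕ) : ℕ := if ℓ = 0 then P.logWidthZero else P.logWidthSub

/-- The number of buckets at subsampling rate `2^(-ℓ)`. -/
def width (P : SketchSize) (ℓ : ℕ) : ℕ := 2 ^ P.logWidth ℓ

/-- The number of bits of a word of a hash seed; large enough that `n`, all numbers of buckets
and all subsampling denominators are at most `2 ^ wordBits`. -/
def wordBits (P : SketchSize) : ℕ := P.rates + P.logWidthZero + P.logWidthSub + 1

/-- The field with `2 ^ wordBits` elements, over which the hash functions are polynomials. -/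
abbrev Word (P : SketchSize) : Type := GaloisField 2 P.wordBits

/-- Some numbering of the field by `0, …, 2 ^ wordBits - 1`. -/
def decode (P : SketchSize) : P.Word ≃ Fin (2 ^ P.wordBits) :=
  Finite.equivFinOfCardEq (GaloisField.card 2 P.wordBits (Nat.succ_ne_zero _))

/-- The field element that stands for row `i`. -/
def point (P : SketchSize) {n : ℕ} (i : Fin n) : P.Word :=
  P.decode.symm (Fin.ofNat (2 ^ P.wordBits) i)

/-- The hash value of row `i` under the polynomial with `k` coefficients `a`.  For uniformly random
`a` these values are `k`-wise independent and uniform on `0, …, 2 ^ wordBits - 1`, and so are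
their residues modulo a smaller power of two. -/
def hashValue (P : SketchSize) {k n : ℕ} (a : Fin k → P.Word) (i : Fin n) : ℕ :=
  P.decode (∑ e : Fin k, a e * P.point i ^ (e : ℕ))

end SketchSize

/-- The raw randomness of one sampling instance: seeds of the pairwise independent hash functions
and of the `4`-wise independent signs of every basic heavy hitter structure, seeds of the
pairwise independent subsampling at every rate (drawn uniformly by the algorithm), the
uniform number `ζ ∈ [1/2, 1]`, and two uniform numbers in `[0, 1)` that drive the choice of the
magnitude level and of the row. -/
structure Randomness (P : SketchSize) where
  hashSeed : Fin (P.rates + 1) → Fin P.reps → Fin 2 → P.Word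
  signSeed : Fin (P.rates + 1) → Fin P.reps → Fin 4 → P.Word
  rateSeed : Fin (P.rates + 1) → Fin 2 → P.Word
  zeta : Set.Icc (1 / 2 : ℝ) 1
  levelDraw : Set.Ico (0 : ℝ) 1
  rowDraw : Set.Ico (0 : ℝ) 1

namespace Randomness

variable {P : SketchSize} {n : ℕ}

/-- The bucket of row `i` in repetition `r` of the heavy hitter structure at rate `2^(-ℓ)`. -/
def bucket (ρ : Randomness P) (ℓ : Fin (P.rates + 1)) (r : Fin P.reps) (i : Fin n) :
    Fin (P.width ℓ) :=
  ⟨P.hashValue (ρ.hashSeed ℓ r) i % P.width ℓ, Nat.mod_lt _ (Nat.two_pow_pos _)⟩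

/-- The random sign of row `i` in repetition `r` of the heavy hitter structure at rate `2^(-ℓ)`. -/
def sign (ρ : Randomness P) (ℓ : Fin (P.rates + 1)) (r : Fin P.reps) (i : Fin n) : ℝ :=
  if P.hashValue (ρ.signSeed ℓ r) i % 2 = 0 then 1 else -1

/-- Row `i` survives the subsampling at rate `2^(-ℓ)`. -/
def Kept (ρ : Randomness P) (ℓ : Fin (P.rates + 1)) (i : Fin n) : Prop :=
  P.hashValue (ρ.rateSeed ℓ) i % 2 ^ (ℓ : ℕ) = 0

end Randomness

/-- A turnstile update `X_{row, col} ← X_{row, col} + amount` of the streamed matrix. -/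
structure Update (n m : ℕ) where
  row : Fin n
  col : Fin m
  amount : ℝ

/-- The matrix that a stream of updates builds up from the zero matrix. -/
def streamMatrix {n m : ℕ} (S : List (Update n m)) : Matrix (Fin n) (Fin m) ℝ :=
  Matrix.of fun i k => (S.map fun e => if e.row = i ∧ e.col = k then e.amount else 0).sum

/-- The positions of the hash tables of one instance: at each rate and in each repetition,
every bucket holds a vector of `d + 1` numbers. -/
abbrev TableCell (P : SketchSize) (d : ℕ) : Type :=
  Σ ℓ : Fin (P.rates + 1), Fin P.reps × Fin (P.width ℓ) × Fin (d + 1)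

/-- The content of the hash tables of one instance. -/
abbrev Tables (P : SketchSize) (d : ℕ) : Type := TableCell P d → ℝ

open Classical in
/-- Processing one update of the stream. -/
def processUpdate {P : SketchSize} {n d : ℕ} (ρ : Randomness P) (H : Tables P d)
    (e : Update n (d + 1)) : Tables P d :=
  fun c => H c +
    if ρ.Kept c.1 e.row ∧ ρ.bucket c.1 c.2.1 e.row = c.2.2.1 ∧ e.col = c.2.2.2
    then ρ.sign c.1 c.2.1 e.row * e.amount else 0

/-- The hash tables after one pass over the stream. -/
def sketchStream {P : SketchSize} {n d : ℕ} (ρ : Randomness P) (S : List (Update n (d + 1))) :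
    Tables P d :=
  S.foldl (processUpdate ρ) 0

/-! ### Sampling from the sketch -/

/-- The position of the median of a nonempty list of numbers. -/
def medianIndex {R : ℕ} (hR : 0 < R) (x : Fin R → ℝ) : Fin R :=
  Tuple.sort x ⟨R / 2, Nat.div_lt_self hR one_lt_two⟩

open Classical in
/-- A choice from `Fin m` with probabilities proportional to the nonnegative weights `w`, driven
by a uniform `τ ∈ [0, 1)`; there is none if all weights vanish. -/
def weightedPick {m : ℕ} (w : Fin m → ℝ) (τ : ℝ) : Option (Fin m) :=
  if hne : (Finset.univ.filter fun k => τ * ∑ i, w i < ∑ i ∈ Finset.Iic k, w i).Nonempty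
  then some (Finset.min' _ hne) else none

namespace Randomness

variable {P : SketchSize} {d : ℕ} (n : ℕ) (ρ : Randomness P) (H : Tables P d)

/-- The vector found for row `i` in repetition `r`, with the random sign of the row undone. -/
def bucketVector {n : ℕ} (ℓ : Fin (P.rates + 1)) (i : Fin n) (r : Fin P.reps) :
    Fin (d + 1) → ℝ :=
  fun k => ρ.sign ℓ r i * H ⟨ℓ, r, ρ.bucket ℓ r i, k⟩

/-- The query of row `i` at rate `2^(-ℓ)`: the vector of median transformed norm. -/
def query {n : ℕ} (ℓ : Fin (P.rates + 1)) (i : Fin n) : Fin (d + 1) → ℝ :=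
  ρ.bucketVector H ℓ i
    (medianIndex P.reps_pos fun r => l2norm (transformRow (ρ.bucketVector H ℓ i r)))

/-- The estimate `λ` of the squared transformed norm of row `i` at rate `2^(-ℓ)`. -/
def weight {n : ℕ} (ℓ : Fin (P.rates + 1)) (i : Fin n) : ℝ :=
  l2norm (transformRow (ρ.query H ℓ i)) ^ 2

open Classical in
/-- `Λ_ℓ`: the surviving rows of largest estimate at rate `2^(-ℓ)`, ties broken by position. -/
def heavy (ℓ : Fin (P.rates + 1)) : Finset (Fin n) :=
  Finset.univ.filter fun i => ρ.Kept ℓ i ∧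
    (Finset.univ.filter fun i' : Fin n => ρ.Kept ℓ i' ∧
      (ρ.weight H ℓ i < ρ.weight H ℓ i' ∨
        (ρ.weight H ℓ i' = ρ.weight H ℓ i ∧ i' < i))).card < P.top

open Classical in
/-- The rows of `Λ_ℓ` with estimate in the (slightly shrunk) magnitude level `j`, that is in
`[(1 + η) ζ M̂ / 2^j, (2 - η) ζ M̂ / 2^j]`. -/
def inLevel (Mhat : ℝ) (ℓ : Fin (P.rates + 1)) (j : ℕ) : Finset (Fin n) :=
  (ρ.heavy n H ℓ).filter fun i =>
    (1 + P.eta) * (ρ.zeta * Mhat / 2 ^ j) ≤ ρ.weight H ℓ i ∧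
      ρ.weight H ℓ i ≤ (2 - P.eta) * (ρ.zeta * Mhat / 2 ^ j)

open Classical in
/-- The subsampling rate used for level `j`: none (`ℓ = 0`) for `j ≤ j₀`, and otherwise the
largest `ℓ` at which the number of rows in the level is between `(1 - √20 η) L² / η²` and
`2 (1 + √20 η) L² / η²`, if there is one. -/
def levelRate (Mhat : ℝ) (j : ℕ) : Option (Fin (P.rates + 1)) :=
  if j ≤ P.directLevels then some 0
  else if hne : (Finset.univ.filter fun ℓ : Fin (P.rates + 1) =>
      (1 - Real.sqrt 20 * P.eta) * P.levels ^ 2 / P.eta ^ 2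
          ≤ ((ρ.inLevel n H Mhat ℓ j).card : ℝ) ∧
        ((ρ.inLevel n H Mhat ℓ j).card : ℝ)
          ≤ 2 * (1 + Real.sqrt 20 * P.eta) * P.levels ^ 2 / P.eta ^ 2).Nonempty
  then some (Finset.max' _ hne) else none

/-- `M̃_j`: the estimated total weight of level `j`. -/
def levelMass (Mhat : ℝ) (j : ℕ) : ℝ :=
  match ρ.levelRate n H Mhat j with
  | none => 0
  | some ℓ => 2 ^ (ℓ : ℕ) * ∑ i ∈ ρ.inLevel n H Mhat ℓ j, ρ.weight H ℓ i

open Classical in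
/-- One sample from the sketch: choose a level `j*` in `1, …, L` with probability proportional to
`M̃_j`, then a row `i*` of that level with probability proportional to its estimate `λ`, and
return `i*`, the transformed query `g(v)` of `i*`, and the probability `λ / ∑_j M̃_j`.
There is no sample if nothing has been recovered. -/
def sample (Mhat : ℝ) : Option (RowSample n d) :=
  (weightedPick (fun j : Fin P.levels => ρ.levelMass n H Mhat (j + 1)) ρ.levelDraw).bind
    fun j => (ρ.levelRate n H Mhat (j + 1)).bind
      fun ℓ => (weightedPick
          (fun i : Fin n => if i ∈ ρ.inLevel n H Mhat ℓ (j + 1) then ρ.weight H ℓ i else 0)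
          ρ.rowDraw).map
        fun i =>
          { index := i
            row := transformRow (ρ.query H ℓ i)
            prob := ρ.weight H ℓ i / ∑ j' : Fin P.levels, ρ.levelMass n H Mhat (j' + 1) }

end Randomness

/-! ### Space -/

/-- The number of bits of all hash seeds of one instance. -/
def seedBits (P : SketchSize) : ℕ :=
  ((P.rates + 1) * P.reps * (2 + 4) + (P.rates + 1) * 2) * P.wordBits

/-- The space of one instance, in words: the hash tables; the seeds (counted in bits); position
and estimate of the heavy hitters at each rate; rate and estimated weight of each magnitude level;
the numbers `ζ`, `M̂` and the two draws; and the sample that is returned. -/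
def instanceSpace (P : SketchSize) (d : ℕ) : ℕ :=
  Fintype.card (TableCell P d) + seedBits P + (P.rates + 1) * P.top * 2 + P.levels * 2 + 4
    + (d + 3)

/-- The space of the regression algorithm, in words: `s` parallel instances, the matrix
`T = (M̃  b̃)`, and the output `x̃`. -/
def totalSpace (P : SketchSize) (d s : ℕ) : ℕ :=
  s * instanceSpace P d + s * (d + 1) + d

end

end RegSketch

open RegSketch

/-!
Let `Q = (M  b)` and `y = (x, -1)`, so that the residual `M x - b` is `Q y`. A good sample of row
`v`, divided by the square root of its probability, has an inner product with `y` of at most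
`‖Q‖_F ‖y‖ (|cos v| + γ) / √(1 - γ)` in absolute value, where `cos v` is the cosine of the angle
between `Q_v` and `y`. Under squared-norm sampling `cos² v` lies in `[0, 1]` and has mean about
`(‖Q y‖ / (‖Q‖_F ‖y‖))²`, so a Chernoff bound for one fixed `y` gives
`‖T y‖ ≤ (1 + ε) ‖Q y‖ + ε ‖Q‖_F ‖y‖` with high probability. No union bound over `y` is needed: the
sketched minimum is at most the sketched cost of one exact minimizer `x`, and if `M x` is the
orthogonal projection of `b`, then `‖x‖ ≤ ‖b‖ / σ_d`, which bounds `ε ‖Q‖_F ‖y‖` by `Δ`.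
In the space bound, each size of the sketch is polynomial in the logarithmic factors and `1 / ε`,
and the number of samples times the number of columns contributes the main term.
-/

namespace RegSketch

section SingularValues

variable {𝕜 E F : Type*} [RCLike 𝕜] [NormedAddCommGroup E] [InnerProductSpace 𝕜 E]
  [FiniteDimensional 𝕜 E] [NormedAddCommGroup F] [InnerProductSpace 𝕜 F] [FiniteDimensional 𝕜 F]

theorem norm_apply_sq_eq_sum_singularValues_sq_mul (T : E →ₗ[𝕜] F) {m : ℕ}
    (hm : Module.finrank 𝕜 E = m) (x : E) :
    ‖T x‖ ^ 2 = ∑ i : Fin m, T.singularValues i ^ 2 *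
      ‖(T.isSymmetric_adjoint_comp_self.eigenvectorBasis hm).repr x i‖ ^ 2 := by
  set e := T.isSymmetric_adjoint_comp_self.eigenvectorBasis hm
  have hform := e.repr.inner_map_map x ((LinearMap.adjoint T ∘ₗ T) x)
  rw [LinearMap.comp_apply, LinearMap.adjoint_inner_right, inner_self_eq_norm_sq_to_K,
    PiLp.inner_apply] at hform
  have hcoord (i : Fin m) : inner 𝕜 (e.repr x i) (e.repr (LinearMap.adjoint T (T x)) i) =
      ((T.singularValues i ^ 2 * ‖e.repr x i‖ ^ 2 : ℝ) : 𝕜) := by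
    rw [← LinearMap.comp_apply, T.isSymmetric_adjoint_comp_self.eigenvectorBasis_apply_self_apply,
      T.sq_singularValues_fin hm, RCLike.inner_apply, mul_assoc, RCLike.mul_conj]
    push_cast
    rfl
  simp_rw [hcoord] at hform
  exact_mod_cast hform.symm

theorem norm_apply_le_singularValues_zero_mul (T : E →ₗ[𝕜] F) (x : E) :
    ‖T x‖ ≤ T.singularValues 0 * ‖x‖ := by
  refine le_of_sq_le_sq ?_ (mul_nonneg (T.singularValues_nonneg 0) (norm_nonneg x))
  rw [mul_pow, norm_apply_sq_eq_sum_singularValues_sq_mul T rfl,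
    ← (T.isSymmetric_adjoint_comp_self.eigenvectorBasis rfl).repr.norm_map x,
    EuclideanSpace.norm_sq_eq, Finset.mul_sum]
  gcongr with i
  · exact T.singularValues_nonneg _
  · exact T.singularValues_antitone (Nat.zero_le _)

theorem singularValues_finrank_sub_one_mul_le_norm_apply (T : E →ₗ[𝕜] F) (x : E) :
    T.singularValues (Module.finrank 𝕜 E - 1) * ‖x‖ ≤ ‖T x‖ := by
  refine le_of_sq_le_sq ?_ (norm_nonneg _)
  rw [mul_pow, norm_apply_sq_eq_sum_singularValues_sq_mul T rfl,
    ← (T.isSymmetric_adjoint_comp_self.eigenvectorBasis rfl).repr.norm_map x,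
    EuclideanSpace.norm_sq_eq, Finset.mul_sum]
  gcongr with i
  · exact T.singularValues_nonneg _
  · exact T.singularValues_antitone (Nat.le_sub_one_of_lt i.2)

end SingularValues

theorem exists_forall_norm_sub_le_and_norm_le {𝕜 E F : Type*} [RCLike 𝕜] [AddCommGroup E]
    [Module 𝕜 E] [NormedAddCommGroup F] [InnerProductSpace 𝕜 F] (T : E →ₗ[𝕜] F)
    [(LinearMap.range T).HasOrthogonalProjection] (b : F) :
    ∃ x, (∀ y, ‖T x - b‖ ≤ ‖T y - b‖) ∧ ‖T x‖ ≤ ‖b‖ := by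
  obtain ⟨x, hx⟩ := (LinearMap.range T).starProjection_apply_mem b
  refine ⟨x, fun y => ?_, hx ▸ (LinearMap.range T).norm_starProjection_apply_le b⟩
  rw [hx, norm_sub_rev, Submodule.starProjection_minimal, norm_sub_rev _ b]
  exact ciInf_le ⟨0, Set.forall_mem_range.2 fun _ => norm_nonneg _⟩
    (⟨T y, LinearMap.mem_range_self T y⟩ : LinearMap.range T)

section Norms

variable {ι : Type*} [Fintype ι] {n d : ℕ}

theorem l2norm_nonneg (v : ι → ℝ) : 0 ≤ l2norm v := norm_nonneg _

theorem l2norm_sq (v : ι → ℝ) : l2norm v ^ 2 = ∑ i, v i ^ 2 := by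
  simp only [l2norm, EuclideanSpace.real_norm_sq_eq]

theorem l2norm_eq_sqrt (v : ι → ℝ) : l2norm v = √(∑ i, v i ^ 2) := by
  rw [← l2norm_sq, Real.sqrt_sq (l2norm_nonneg v)]

theorem l2norm_add_le (v w : ι → ℝ) : l2norm (v + w) ≤ l2norm v + l2norm w := norm_add_le _ _

theorem l2norm_smul (c : ℝ) (v : ι → ℝ) : l2norm (c • v) = |c| * l2norm v :=
  norm_smul c (WithLp.toLp 2 v)

theorem l2norm_single [DecidableEq ι] (i : ι) (c : ℝ) : l2norm (Pi.single i c) = |c| :=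
  PiLp.norm_single 2 (fun _ => ℝ) i c

theorem l2norm_le_of_abs_le {v w : ι → ℝ} (h : ∀ i, |v i| ≤ w i) : l2norm v ≤ l2norm w := by
  simp only [l2norm_eq_sqrt]
  gcongr √(∑ i, ?_) with i
  exact sq_le_sq.2 ((h i).trans (le_abs_self _))

theorem frobNorm_nonneg (M : Matrix (Fin n) (Fin d) ℝ) : 0 ≤ frobNorm M := Real.sqrt_nonneg _

theorem frobNorm_sq (M : Matrix (Fin n) (Fin d) ℝ) : frobNorm M ^ 2 = ∑ i, l2norm (M i) ^ 2 := by
  simp only [l2norm_sq]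
  exact Real.sq_sqrt (by positivity)

theorem l2norm_row_le_frobNorm (M : Matrix (Fin n) (Fin d) ℝ) (i : Fin n) :
    l2norm (M i) ≤ frobNorm M := by
  refine le_of_sq_le_sq ?_ (frobNorm_nonneg M)
  rw [frobNorm_sq]
  exact Finset.single_le_sum (fun i _ => sq_nonneg (l2norm (M i))) (Finset.mem_univ i)

theorem specNorm_nonneg (M : Matrix (Fin n) (Fin d) ℝ) : 0 ≤ specNorm M := norm_nonneg _

theorem l2norm_mulVec_le (M : Matrix (Fin n) (Fin d) ℝ) (x : Fin d → ℝ) :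
    l2norm (M.mulVec x) ≤ specNorm M * l2norm x :=
  (Matrix.toEuclideanLin M).toContinuousLinearMap.le_opNorm (WithLp.toLp 2 x)

theorem frobNorm_le_sqrt_mul_specNorm (M : Matrix (Fin n) (Fin d) ℝ) :
    frobNorm M ≤ √d * specNorm M := by
  have hcol (j : Fin d) : ∑ i, M i j ^ 2 ≤ specNorm M ^ 2 := by
    have h := l2norm_mulVec_le M (Pi.single j 1)
    rw [l2norm_single, abs_one, mul_one, Matrix.mulVec_single_one] at h
    simpa only [l2norm_sq, Matrix.col_apply] using pow_le_pow_left₀ (l2norm_nonneg _) h 2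
  rw [← Real.sqrt_sq (specNorm_nonneg M), ← Real.sqrt_mul (Nat.cast_nonneg d), frobNorm,
    Finset.sum_comm]
  gcongr
  calc ∑ j, ∑ i, M i j ^ 2 ≤ ∑ _j : Fin d, specNorm M ^ 2 := Finset.sum_le_sum fun j _ => hcol j
    _ = d * specNorm M ^ 2 := by simp

end Norms

section FullRank

variable {n d : ℕ} {M : Matrix (Fin n) (Fin d) ℝ}

theorem specNorm_le_singularValues_zero (M : Matrix (Fin n) (Fin d) ℝ) :
    specNorm M ≤ (Matrix.toEuclideanLin M).singularValues 0 :=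
  ContinuousLinearMap.opNorm_le_bound _ (LinearMap.singularValues_nonneg _ 0)
    (norm_apply_le_singularValues_zero_mul _)

theorem singularValues_sub_one_mul_le_l2norm_mulVec (M : Matrix (Fin n) (Fin d) ℝ)
    (x : Fin d → ℝ) :
    (Matrix.toEuclideanLin M).singularValues (d - 1) * l2norm x ≤ l2norm (M.mulVec x) := by
  have h := singularValues_finrank_sub_one_mul_le_norm_apply (Matrix.toEuclideanLin M)
    (WithLp.toLp 2 x)
  rwa [finrank_euclideanSpace, Fintype.card_fin] at h

theorem singularValues_sub_one_pos (hd : 0 < d) (hM : M.rank = d) :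
    0 < (Matrix.toEuclideanLin M).singularValues (d - 1) := by
  rw [Matrix.rank_eq_finrank_range_toLin M (PiLp.basisFun 2 ℝ (Fin n)) (PiLp.basisFun 2 ℝ (Fin d)),
    ← Matrix.toLpLin_eq_toLin] at hM
  rw [LinearMap.singularValues_pos_iff_lt_finrank_range]
  exact (Nat.sub_lt hd one_pos).trans_eq hM.symm

theorem one_le_condNumber (hd : 0 < d) (hM : M.rank = d) : 1 ≤ condNumber M := by
  rw [condNumber, one_le_div (singularValues_sub_one_pos hd hM)]
  exact LinearMap.singularValues_antitone _ (Nat.zero_le _)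

theorem specNorm_pos (hd : 0 < d) (hM : M.rank = d) : 0 < specNorm M := by
  have hlower := singularValues_sub_one_mul_le_l2norm_mulVec M (Pi.single ⟨0, hd⟩ 1)
  have hupper := l2norm_mulVec_le M (Pi.single ⟨0, hd⟩ 1)
  rw [l2norm_single, abs_one, mul_one] at hlower hupper
  exact (singularValues_sub_one_pos hd hM).trans_le (hlower.trans hupper)

end FullRank

section LeastSquares

variable {n d s : ℕ}

theorem exists_forall_cost_le_and_l2norm_mulVec_le (M : Matrix (Fin n) (Fin d) ℝ)
    (b : Fin n → ℝ) : ∃ x, (∀ y, cost M b x ≤ cost M b y) ∧ l2norm (M.mulVec x) ≤ l2norm b := by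
  obtain ⟨x, hmin, hnorm⟩ := exists_forall_norm_sub_le_and_norm_le (Matrix.toEuclideanLin M)
    (WithLp.toLp 2 b)
  exact ⟨x.ofLp, fun y => hmin (WithLp.toLp 2 y), hnorm⟩

theorem exists_isOutput (h : Fin s → RowSample n d) : ∃ x, IsOutput h x :=
  let ⟨x, hmin, _⟩ := exists_forall_cost_le_and_l2norm_mulVec_le (sketchMatrix h) (sketchVector h)
  ⟨x, fun y _ => hmin y⟩

/-- The vector `(x, -1)`, which turns the residual `M x - b` into the product of the augmented
matrix `(M  b)` with one vector. -/
def augmentVec (x : Fin d → ℝ) : Fin (d + 1) → ℝ := Fin.snoc (α := fun _ => ℝ) x (-1)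

theorem l2norm_augmentVec_le (x : Fin d → ℝ) : l2norm (augmentVec x) ≤ l2norm x + 1 := by
  have hsq : l2norm (augmentVec x) ^ 2 = l2norm x ^ 2 + 1 := by
    simp [l2norm_sq, Fin.sum_univ_castSucc, augmentVec]
  refine le_of_sq_le_sq ?_ (add_nonneg (l2norm_nonneg x) zero_le_one)
  linarith [l2norm_nonneg x, add_sq (l2norm x) 1]

theorem cost_eq_l2norm_augment_mulVec (M : Matrix (Fin n) (Fin d) ℝ) (b : Fin n → ℝ)
    (x : Fin d → ℝ) : cost M b x = l2norm ((augment M b).mulVec (augmentVec x)) := by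
  rw [cost]
  congr 1 with i
  simp [Matrix.mulVec, dotProduct, Fin.sum_univ_castSucc, augment, augmentVec, sub_eq_add_neg]

theorem augment_sketchMatrix_sketchVector (h : Fin s → RowSample n d) :
    augment (sketchMatrix h) (sketchVector h) = sampleMatrix h :=
  Matrix.ext fun t => congrFun (Fin.snoc_init_self (α := fun _ => ℝ) (sampleMatrix h t))

theorem frobNorm_augment (M : Matrix (Fin n) (Fin d) ℝ) (b : Fin n → ℝ) :
    frobNorm (augment M b) = √(frobNorm M ^ 2 + l2norm b ^ 2) := by
  rw [← Real.sqrt_sq (frobNorm_nonneg (augment M b))]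
  simp [frobNorm_sq, l2norm_sq, augment, Fin.sum_univ_castSucc, Finset.sum_add_distrib]

theorem frobNorm_augment_le {M : Matrix (Fin n) (Fin d) ℝ} (b : Fin n → ℝ) (hM : 0 < specNorm M) :
    frobNorm (augment M b) ≤ √(d + l2norm b ^ 2 / specNorm M ^ 2) * specNorm M := by
  have hfrob := pow_le_pow_left₀ (frobNorm_nonneg M) (frobNorm_le_sqrt_mul_specNorm M) 2
  rw [mul_pow, Real.sq_sqrt (Nat.cast_nonneg d)] at hfrob
  rw [frobNorm_augment, Real.sqrt_le_left (by positivity), mul_pow, Real.sq_sqrt (by positivity),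
    add_mul, div_mul_cancel₀ _ (by positivity)]
  gcongr

/-- The additive error `Δ` for a regression problem with an arbitrary matrix `M` in place of
`f(A)`. -/
noncomputable def matrixAdditiveError (M : Matrix (Fin n) (Fin d) ℝ) (b : Fin n → ℝ) (ε : ℝ) : ℝ :=
  ε * (√(d + l2norm b ^ 2 / specNorm M ^ 2) * condNumber M * l2norm b
      + √(frobNorm M ^ 2 + l2norm b ^ 2))

/-- The guarantee of the regression step for an arbitrary matrix `M` in place of `f(A)`: there is
an output, and every output meets the error bound. -/
def MatrixRegressionGuarantee (M : Matrix (Fin n) (Fin d) ℝ) (b : Fin n → ℝ) (ε : ℝ)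
    (h : Fin s → RowSample n d) : Prop :=
  (∃ x, IsOutput h x) ∧
    ∀ x, IsOutput h x →
      cost (sketchMatrix h) (sketchVector h) x ≤
        (1 + ε) * (⨅ y, cost M b y) + matrixAdditiveError M b ε

theorem mul_frobNorm_mul_l2norm_augmentVec_le_matrixAdditiveError
    {M : Matrix (Fin n) (Fin d) ℝ} {b : Fin n → ℝ} {ε : ℝ} (hd : 0 < d) (hM : M.rank = d)
    (hε : 0 ≤ ε) {x : Fin d → ℝ} (hx : l2norm (M.mulVec x) ≤ l2norm b) :
    ε * (frobNorm (augment M b) * l2norm (augmentVec x)) ≤ matrixAdditiveError M b ε := by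
  have hσ := singularValues_sub_one_pos hd hM
  have hxb : l2norm x ≤ l2norm b / (Matrix.toEuclideanLin M).singularValues (d - 1) := by
    rw [le_div_iff₀' hσ]
    exact (singularValues_sub_one_mul_le_l2norm_mulVec M x).trans hx
  have hQ : frobNorm (augment M b) ≤ √(d + l2norm b ^ 2 / specNorm M ^ 2) *
      (Matrix.toEuclideanLin M).singularValues 0 :=
    (frobNorm_augment_le b (specNorm_pos hd hM)).trans
      (mul_le_mul_of_nonneg_left (specNorm_le_singularValues_zero M) (Real.sqrt_nonneg _))
  rw [matrixAdditiveError, ← frobNorm_augment]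
  refine mul_le_mul_of_nonneg_left ?_ hε
  calc frobNorm (augment M b) * l2norm (augmentVec x)
      ≤ frobNorm (augment M b) * (l2norm x + 1) :=
        mul_le_mul_of_nonneg_left (l2norm_augmentVec_le x) (frobNorm_nonneg _)
    _ = frobNorm (augment M b) * l2norm x + frobNorm (augment M b) := by ring
    _ ≤ (√(d + l2norm b ^ 2 / specNorm M ^ 2) * (Matrix.toEuclideanLin M).singularValues 0) *
          (l2norm b / (Matrix.toEuclideanLin M).singularValues (d - 1))
          + frobNorm (augment M b) := by
        gcongr
        · exact l2norm_nonneg x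
        · exact (frobNorm_nonneg _).trans hQ
    _ = _ := by rw [condNumber]; ring

end LeastSquares

section Chernoff

variable {Ω : Type*} [MeasurableSpace Ω] {μ : Measure Ω} [IsProbabilityMeasure μ]

theorem exp_mul_le_one_add_mul {θ x : ℝ} (hθ : θ ∈ Set.Icc (0 : ℝ) 1)
    (hx : x ∈ Set.Icc (0 : ℝ) 1) : Real.exp (θ * x) ≤ 1 + (θ + θ ^ 2) * x := by
  have hθx : 0 ≤ θ * x := mul_nonneg hθ.1 hx.1
  have hexp := Real.abs_exp_sub_one_sub_id_le (x := θ * x)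
    (by rw [abs_of_nonneg hθx]; exact mul_le_one₀ hθ.2 hx.1 hx.2)
  have hsq : θ ^ 2 * x ^ 2 ≤ θ ^ 2 * x := by gcongr; exact pow_le_of_le_one hx.1 hx.2 two_ne_zero
  linarith [(abs_le.1 hexp).2, mul_pow θ x 2]

theorem mgf_le_exp_mul_integral {X : Ω → ℝ} (hX : AEMeasurable X μ)
    (hIcc : ∀ᵐ ω ∂μ, X ω ∈ Set.Icc (0 : ℝ) 1) {θ : ℝ} (hθ : θ ∈ Set.Icc (0 : ℝ) 1) :
    mgf X μ θ ≤ Real.exp ((θ + θ ^ 2) * ∫ ω, X ω ∂μ) := by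
  have hint : Integrable X μ := Integrable.of_mem_Icc 0 1 hX hIcc
  calc mgf X μ θ ≤ ∫ ω, (1 + (θ + θ ^ 2) * X ω) ∂μ :=
        integral_mono_ae (integrable_exp_mul_of_mem_Icc hX hIcc)
          ((integrable_const 1).add (hint.const_mul _))
          (hIcc.mono fun ω hω => exp_mul_le_one_add_mul hθ hω)
    _ = (θ + θ ^ 2) * ∫ ω, X ω ∂μ + 1 := by
        rw [integral_add (integrable_const _) (hint.const_mul _), integral_const_mul]
        simp [add_comm]
    _ ≤ _ := Real.add_one_le_exp _

theorem sq_le_mul_sq_sub_mul_sq {q η θ : ℝ} (hθ : θ ∈ Set.Icc (0 : ℝ) 1)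
    (hθη : θ * (q + η) = η) : η ^ 2 ≤ θ * (q + η) ^ 2 - (θ + θ ^ 2) * q ^ 2 := by
  have hgap : θ * (q + η) ^ 2 - (θ + θ ^ 2) * q ^ 2 = η ^ 2 + η ^ 2 * (θ * (1 - θ)) := by
    linear_combination (2 * η * θ - θ * (q + η) + η) * hθη
  rw [hgap]
  exact le_add_of_nonneg_right
    (mul_nonneg (sq_nonneg η) (mul_nonneg hθ.1 (sub_nonneg.2 hθ.2)))

theorem measureReal_sum_ge_le_exp {ι : Type*} [Fintype ι] {X : ι → Ω → ℝ}
    (hX : ∀ i, AEMeasurable (X i) μ) (hind : iIndepFun X μ)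
    (hIcc : ∀ i, ∀ᵐ ω ∂μ, X i ω ∈ Set.Icc (0 : ℝ) 1) {q η : ℝ}
    (hmean : ∀ i, ∫ ω, X i ω ∂μ ≤ q ^ 2) (hq : 0 ≤ q) (hη : 0 ≤ η) :
    μ.real {ω | Fintype.card ι * (q + η) ^ 2 ≤ ∑ i, X i ω} ≤
      Real.exp (-(Fintype.card ι * η ^ 2)) := by
  obtain ⟨θ, hθ, hθη⟩ : ∃ θ ∈ Set.Icc (0 : ℝ) 1, θ * (q + η) = η :=
    ⟨η / (q + η), ⟨by positivity, div_le_one_of_le₀ (by linarith) (by positivity)⟩,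
      div_mul_cancel_of_imp fun h => by linarith⟩
  have hint : Integrable (fun ω => Real.exp (θ * ∑ i, X i ω)) μ := by
    refine integrable_exp_mul_of_mem_Icc (a := 0) (b := Fintype.card ι)
      (Finset.aemeasurable_fun_sum _ fun i _ => hX i) ?_
    filter_upwards [ae_all_iff.2 hIcc] with ω hω
    exact ⟨Finset.sum_nonneg fun i _ => (hω i).1,
      (Finset.sum_le_sum fun i _ => (hω i).2).trans_eq (by simp)⟩
  have hmgf : mgf (fun ω => ∑ i, X i ω) μ θ ≤
      Real.exp (Fintype.card ι * ((θ + θ ^ 2) * q ^ 2)) := by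
    rw [show (fun ω => ∑ i, X i ω) = ∑ i, X i from funext fun ω => (Finset.sum_apply ..).symm,
      hind.mgf_sum₀ hX, Real.exp_nat_mul, ← Finset.card_univ, ← Finset.prod_const]
    gcongr with i
    · exact fun _ _ => mgf_nonneg
    · refine (mgf_le_exp_mul_integral (hX i) (hIcc i) hθ).trans ?_
      have := hθ.1
      gcongr
      exact hmean i
  calc μ.real {ω | Fintype.card ι * (q + η) ^ 2 ≤ ∑ i, X i ω}
      ≤ Real.exp (-θ * (Fintype.card ι * (q + η) ^ 2)) * mgf (fun ω => ∑ i, X i ω) μ θ :=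
        measure_ge_le_exp_mul_mgf _ hθ.1 hint
    _ ≤ Real.exp (-θ * (Fintype.card ι * (q + η) ^ 2)) *
          Real.exp (Fintype.card ι * ((θ + θ ^ 2) * q ^ 2)) := by gcongr
    _ = Real.exp (-(Fintype.card ι * (θ * (q + η) ^ 2 - (θ + θ ^ 2) * q ^ 2))) := by
        rw [← Real.exp_add]; ring_nf
    _ ≤ _ := by
        gcongr
        exact sq_le_mul_sq_sub_mul_sq hθ hθη

end Chernoff

theorem integral_comp_le_sum_mul {Ω α : Type*} [MeasurableSpace Ω] {μ : Measure Ω}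
    [IsFiniteMeasure μ] [Fintype α] [MeasurableSpace α] [MeasurableSingletonClass α] {U : Ω → α}
    (hU : AEMeasurable U μ) {q g : α → ℝ} (hq : ∀ v, 0 ≤ q v) (hg : ∀ v, 0 ≤ g v)
    (hlaw : ∀ v, μ {ω | U ω = v} ≤ ENNReal.ofReal (q v)) :
    ∫ ω, g (U ω) ∂μ ≤ ∑ v, q v * g v := by
  rw [← integral_map hU (measurable_of_finite g).aestronglyMeasurable,
    integral_fintype Integrable.of_finite]
  refine Finset.sum_le_sum fun v _ => mul_le_mul_of_nonneg_right ?_ (hg v)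
  rw [map_measureReal_apply_of_aemeasurable hU (measurableSet_singleton v)]
  exact ENNReal.toReal_le_of_le_ofReal (hq v) (hlaw v)

section Sampling

variable {n d m s : ℕ}

/-- The cosine of the angle between row `v` of `Q` and the vector `y`; it is `0` when one of them
vanishes. -/
noncomputable def rowCos (Q : Matrix (Fin n) (Fin m) ℝ) (y : Fin m → ℝ) (v : Fin n) : ℝ :=
  Real.cos (InnerProductGeometry.angle (WithLp.toLp 2 (Q v)) (WithLp.toLp 2 y))

theorem rowCos_sq_mem_Icc (Q : Matrix (Fin n) (Fin m) ℝ) (y : Fin m → ℝ) (v : Fin n) :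
    rowCos Q y v ^ 2 ∈ Set.Icc (0 : ℝ) 1 :=
  ⟨sq_nonneg _, Real.cos_sq_le_one _⟩

theorem mulVec_apply_eq_mul_rowCos (Q : Matrix (Fin n) (Fin m) ℝ) (y : Fin m → ℝ) (v : Fin n) :
    Q.mulVec y v = l2norm (Q v) * l2norm y * rowCos Q y v := by
  have h := InnerProductGeometry.cos_angle_mul_norm_mul_norm (WithLp.toLp 2 (Q v))
    (WithLp.toLp 2 y)
  rw [EuclideanSpace.inner_toLp_toLp, star_trivial, dotProduct_comm] at h
  exact h.symm.trans (mul_comm _ _)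

theorem abs_dotProduct_le_l2norm_mul_l2norm {ι : Type*} [Fintype ι] (v w : ι → ℝ) :
    |v ⬝ᵥ w| ≤ l2norm v * l2norm w := by
  have h := abs_real_inner_le_norm (WithLp.toLp 2 v) (WithLp.toLp 2 w)
  rwa [EuclideanSpace.inner_toLp_toLp, star_trivial, dotProduct_comm] at h

theorem rowProb_nonneg (Q : Matrix (Fin n) (Fin m) ℝ) (v : Fin n) : 0 ≤ rowProb Q v := by
  unfold rowProb; positivity

theorem frobNorm_mul_sqrt_rowProb (Q : Matrix (Fin n) (Fin m) ℝ) (v : Fin n) :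
    frobNorm Q * √(rowProb Q v) = l2norm (Q v) := by
  rw [rowProb, ← div_pow, Real.sqrt_sq (div_nonneg (l2norm_nonneg _) (frobNorm_nonneg _))]
  exact mul_div_cancel_of_imp' fun h =>
    le_antisymm (h ▸ l2norm_row_le_frobNorm Q v) (l2norm_nonneg _)

theorem sum_rowProb_mul_rowCos_sq (Q : Matrix (Fin n) (Fin m) ℝ) (y : Fin m → ℝ) :
    ∑ v, rowProb Q v * rowCos Q y v ^ 2 =
      (l2norm (Q.mulVec y) / (frobNorm Q * l2norm y)) ^ 2 := by
  rw [div_pow, l2norm_sq, Finset.sum_div]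
  refine Finset.sum_congr rfl fun v _ => ?_
  rw [mulVec_apply_eq_mul_rowCos]
  rcases eq_or_ne (l2norm y) 0 with hy | hy
  · have hy0 : WithLp.toLp 2 y = 0 := norm_eq_zero.1 hy
    simp [rowCos, hy0]
  · rw [rowProb, mul_pow, mul_pow, mul_pow, mul_right_comm,
      mul_div_mul_right _ _ (pow_ne_zero 2 hy), mul_div_right_comm]

theorem IsGoodSample.abs_row_dotProduct_le {γ : ℝ} {Q : Matrix (Fin n) (Fin (d + 1)) ℝ}
    {h : RowSample n d} (hgood : IsGoodSample γ Q h) (y : Fin (d + 1) → ℝ) :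
    |h.row ⬝ᵥ y| ≤ l2norm (Q h.index) * l2norm y * (|rowCos Q y h.index| + γ) := by
  have hexact : |Q h.index ⬝ᵥ y| = l2norm (Q h.index) * l2norm y * |rowCos Q y h.index| := by
    rw [← abs_of_nonneg (mul_nonneg (l2norm_nonneg (Q h.index)) (l2norm_nonneg y)), ← abs_mul,
      ← mulVec_apply_eq_mul_rowCos]
    rfl
  have hnoise : |(h.row - Q h.index) ⬝ᵥ y| ≤ γ * l2norm (Q h.index) * l2norm y :=
    (abs_dotProduct_le_l2norm_mul_l2norm _ y).trans
      (mul_le_mul_of_nonneg_right hgood.2 (l2norm_nonneg y))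
  calc |h.row ⬝ᵥ y| = |Q h.index ⬝ᵥ y + (h.row - Q h.index) ⬝ᵥ y| := by
        rw [← add_dotProduct, add_sub_cancel]
    _ ≤ |Q h.index ⬝ᵥ y| + |(h.row - Q h.index) ⬝ᵥ y| := abs_add_le _ _
    _ ≤ _ := by rw [hexact]; linarith

theorem IsGoodSample.sqrt_rowProb_div_sqrt_prob_le {γ : ℝ} {Q : Matrix (Fin n) (Fin (d + 1)) ℝ}
    {h : RowSample n d} (hgood : IsGoodSample γ Q h) (hγ : γ < 1) :
    √(rowProb Q h.index) / √h.prob ≤ (√(1 - γ))⁻¹ := by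
  refine div_le_of_le_mul₀ (Real.sqrt_nonneg _) (by positivity) ?_
  rw [le_inv_mul_iff₀ (Real.sqrt_pos.2 (sub_pos.2 hγ)), ← Real.sqrt_mul (sub_nonneg.2 hγ.le)]
  exact Real.sqrt_le_sqrt (by linarith [(abs_le.1 hgood.1).1])

theorem abs_sampleMatrix_mulVec_apply_le {γ : ℝ} {Q : Matrix (Fin n) (Fin (d + 1)) ℝ}
    {h : Fin s → RowSample n d} {t : Fin s} (hgood : IsGoodSample γ Q (h t)) (hγ : 0 ≤ γ)
    (hγ1 : γ < 1) (y : Fin (d + 1) → ℝ) :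
    |(sampleMatrix h).mulVec y t| ≤
      frobNorm Q * l2norm y / (√s * √(1 - γ)) * (|rowCos Q y (h t).index| + γ) := by
  have hT : (sampleMatrix h).mulVec y t = ((h t).row ⬝ᵥ y) / √(s * (h t).prob) := by
    simp only [Matrix.mulVec, dotProduct, sampleMatrix, Matrix.of_apply, Finset.sum_div,
      div_mul_eq_mul_div]
  have hy := l2norm_nonneg y
  have hQ := frobNorm_nonneg Q
  rw [hT, abs_div, abs_of_nonneg (Real.sqrt_nonneg _), Real.sqrt_mul (Nat.cast_nonneg s)]
  calc |(h t).row ⬝ᵥ y| / (√s * √(h t).prob)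
      ≤ frobNorm Q * √(rowProb Q (h t).index) * l2norm y * (|rowCos Q y (h t).index| + γ) /
          (√s * √(h t).prob) := by
        rw [frobNorm_mul_sqrt_rowProb]
        exact div_le_div_of_nonneg_right (hgood.abs_row_dotProduct_le y) (by positivity)
    _ = frobNorm Q * l2norm y / √s * (√(rowProb Q (h t).index) / √(h t).prob) *
          (|rowCos Q y (h t).index| + γ) := by ring
    _ ≤ frobNorm Q * l2norm y / √s * (√(1 - γ))⁻¹ * (|rowCos Q y (h t).index| + γ) := by
        gcongr
        exact hgood.sqrt_rowProb_div_sqrt_prob_le hγ1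
    _ = _ := by ring

theorem l2norm_sampleMatrix_mulVec_le {γ a : ℝ} {Q : Matrix (Fin n) (Fin (d + 1)) ℝ}
    {h : Fin s → RowSample n d} (hgood : ∀ t, IsGoodSample γ Q (h t)) (hγ : 0 ≤ γ)
    (hγ1 : γ < 1) (ha : 0 ≤ a) (y : Fin (d + 1) → ℝ)
    (hcos : ∑ t, rowCos Q y (h t).index ^ 2 ≤ s * a ^ 2) :
    l2norm ((sampleMatrix h).mulVec y) ≤ frobNorm Q * l2norm y * (a + γ) / √(1 - γ) := by
  set r := frobNorm Q * l2norm y / (√s * √(1 - γ)) with hr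
  have hR : 0 ≤ frobNorm Q * l2norm y := mul_nonneg (frobNorm_nonneg Q) (l2norm_nonneg y)
  have hr0 : 0 ≤ r := by positivity
  have hcosNorm : l2norm (fun t => |rowCos Q y (h t).index|) ≤ √s * a := by
    rw [l2norm_eq_sqrt, ← Real.sqrt_sq ha, ← Real.sqrt_mul (Nat.cast_nonneg s)]
    simpa only [sq_abs] using Real.sqrt_le_sqrt hcos
  have hconstNorm : l2norm (fun _ : Fin s => γ) = √s * γ := by
    simp [l2norm_eq_sqrt, Real.sqrt_sq hγ]
  calc l2norm ((sampleMatrix h).mulVec y)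
      ≤ l2norm (r • ((fun t => |rowCos Q y (h t).index|) + fun _ => γ)) :=
        l2norm_le_of_abs_le fun t => abs_sampleMatrix_mulVec_apply_le (hgood t) hγ hγ1 y
    _ = r * l2norm ((fun t => |rowCos Q y (h t).index|) + fun _ => γ) := by
        rw [l2norm_smul, abs_of_nonneg hr0]
    _ ≤ r * (√s * a + √s * γ) := by
        gcongr
        exact (l2norm_add_le _ _).trans (add_le_add hcosNorm hconstNorm.le)
    _ = √s / √s * (frobNorm Q * l2norm y * (a + γ) / √(1 - γ)) := by rw [hr]; ring
    _ ≤ _ := mul_le_of_le_one_left (by positivity) (div_self_le_one _)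

theorem inv_sqrt_one_sub_le_one_add {x : ℝ} (hx : 0 ≤ x) (hx2 : x ≤ 1 / 2) :
    (√(1 - x))⁻¹ ≤ 1 + x := by
  have hpos : 0 < 1 - x := by linarith
  rw [inv_le_iff_one_le_mul₀ (Real.sqrt_pos.2 hpos), ← Real.sqrt_sq (by linarith : 0 ≤ 1 + x),
    ← Real.sqrt_mul (sq_nonneg _), Real.one_le_sqrt]
  have hquad : 0 ≤ 1 - x - x ^ 2 := by nlinarith
  linear_combination mul_nonneg hx hquad

theorem GoodSampling.measureReal_le_sum_rowCos_sq_le {Ω : Type u} [MeasurableSpace Ω]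
    {μ : Measure Ω} [IsProbabilityMeasure μ] {Q : Matrix (Fin n) (Fin (d + 1)) ℝ} {γ : ℝ}
    {h : Fin s → Ω → RowSample n d} (H : GoodSampling μ γ Q h) (hγ : 0 ≤ γ)
    (y : Fin (d + 1) → ℝ) :
    μ.real {ω | s * ((1 + γ) * (l2norm (Q.mulVec y) / (frobNorm Q * l2norm y)) + γ) ^ 2 ≤
      ∑ t, rowCos Q y (h t ω).index ^ 2} ≤ Real.exp (-(s * γ ^ 2)) := by
  have hcos : Measurable fun v => rowCos Q y v ^ 2 := measurable_of_finite _
  have hratio : 0 ≤ l2norm (Q.mulVec y) / (frobNorm Q * l2norm y) :=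
    div_nonneg (l2norm_nonneg _) (mul_nonneg (frobNorm_nonneg _) (l2norm_nonneg _))
  have hmean (t : Fin s) : ∫ ω, rowCos Q y (h t ω).index ^ 2 ∂μ ≤
      ((1 + γ) * (l2norm (Q.mulVec y) / (frobNorm Q * l2norm y))) ^ 2 := by
    calc ∫ ω, rowCos Q y (h t ω).index ^ 2 ∂μ
        ≤ ∑ v, (1 + γ) * rowProb Q v * rowCos Q y v ^ 2 :=
          integral_comp_le_sum_mul (H.measurable_index t).aemeasurable
            (fun v => mul_nonneg (by positivity) (rowProb_nonneg Q v))
            (fun v => sq_nonneg (rowCos Q y v)) (H.law t)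
      _ = (1 + γ) * (l2norm (Q.mulVec y) / (frobNorm Q * l2norm y)) ^ 2 := by
          simp_rw [mul_assoc]
          rw [← Finset.mul_sum, sum_rowProb_mul_rowCos_sq]
      _ ≤ _ := by
          rw [mul_pow]
          gcongr
          exact le_self_pow₀ (by linarith) two_ne_zero
  simpa only [Fintype.card_fin, Function.comp_apply] using measureReal_sum_ge_le_exp
    (fun t => (hcos.comp (H.measurable_index t)).aemeasurable) (H.indep.comp _ fun _ => hcos)
    (fun t => ae_of_all μ fun ω => rowCos_sq_mem_Icc Q y (h t ω).index) hmean (by positivity) hγ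

theorem GoodSampling.measure_lt_l2norm_sampleMatrix_mulVec_le {Ω : Type u} [MeasurableSpace Ω]
    {μ : Measure Ω} [IsProbabilityMeasure μ] {Q : Matrix (Fin n) (Fin (d + 1)) ℝ} {ε : ℝ}
    {h : Fin s → Ω → RowSample n d} (H : GoodSampling μ (ε / 4) Q h) (hε : 0 ≤ ε) (hε1 : ε ≤ 1)
    (y : Fin (d + 1) → ℝ) :
    μ {ω | (1 + ε) * l2norm (Q.mulVec y) + ε * (frobNorm Q * l2norm y) <
      l2norm ((sampleMatrix fun t => h t ω).mulVec y)} ≤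
        ENNReal.ofReal (Real.exp (-(s * (ε / 4) ^ 2))) := by
  set R := frobNorm Q * l2norm y
  have hR0 : 0 ≤ R := mul_nonneg (frobNorm_nonneg Q) (l2norm_nonneg y)
  have hQy := l2norm_nonneg (Q.mulVec y)
  refine le_trans (measure_mono_ae ?_)
    ((ofReal_measureReal ..).symm.trans_le
      (ENNReal.ofReal_le_ofReal (H.measureReal_le_sum_rowCos_sq_le (by positivity) y)))
  filter_upwards [H.good] with ω hgood hbad
  by_contra! hcos
  refine hbad.not_ge ?_
  calc l2norm ((sampleMatrix fun t => h t ω).mulVec y)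
      ≤ R * ((1 + ε / 4) * (l2norm (Q.mulVec y) / R) + ε / 4 + ε / 4) / √(1 - ε / 4) :=
        l2norm_sampleMatrix_mulVec_le hgood (by positivity) (by linarith) (by positivity) y
          (not_le.1 hcos).le
    _ = ((1 + ε / 4) * (l2norm (Q.mulVec y) * (R / R)) + ε / 2 * R) * (√(1 - ε / 4))⁻¹ := by ring
    _ ≤ ((1 + ε / 4) * l2norm (Q.mulVec y) + ε / 2 * R) * (1 + ε / 4) := by
        gcongr
        · exact mul_le_of_le_one_right hQy (div_self_le_one R)
        · exact inv_sqrt_one_sub_le_one_add (by positivity) (by linarith)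
    _ = (1 + ε / 4) ^ 2 * l2norm (Q.mulVec y) + ε * (1 / 2 + ε / 8) * R := by ring
    _ ≤ (1 + ε) * l2norm (Q.mulVec y) + ε * 1 * R := by
        gcongr
        · nlinarith
        · linarith
    _ = _ := by ring

theorem GoodSampling.measure_not_matrixRegressionGuarantee_le {Ω : Type u} [MeasurableSpace Ω]
    {μ : Measure Ω} [IsProbabilityMeasure μ] {M : Matrix (Fin n) (Fin d) ℝ} {b : Fin n → ℝ}
    {ε : ℝ} {h : Fin s → Ω → RowSample n d} (H : GoodSampling μ (ε / 4) (augment M b) h)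
    (hd : 0 < d) (hM : M.rank = d) (hε : 0 ≤ ε) (hε1 : ε ≤ 1) :
    μ {ω | ¬ MatrixRegressionGuarantee M b ε fun t => h t ω} ≤
      ENNReal.ofReal (Real.exp (-(s * (ε / 4) ^ 2))) := by
  obtain ⟨x, hmin, hxb⟩ := exists_forall_cost_le_and_l2norm_mulVec_le M b
  refine (measure_mono fun ω hω => ?_).trans
    (H.measure_lt_l2norm_sampleMatrix_mulVec_le hε hε1 (augmentVec x))
  contrapose! hω
  rw [Set.mem_ofPred_eq, not_lt] at hω
  refine not_not.2 ⟨exists_isOutput _, fun z hz => ?_⟩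
  calc cost (sketchMatrix fun t => h t ω) (sketchVector fun t => h t ω) z
      ≤ cost (sketchMatrix fun t => h t ω) (sketchVector fun t => h t ω) x := hz (Set.mem_univ x)
    _ = l2norm ((sampleMatrix fun t => h t ω).mulVec (augmentVec x)) := by
        rw [cost_eq_l2norm_augment_mulVec, augment_sketchMatrix_sketchVector]
    _ ≤ (1 + ε) * cost M b x + ε * (frobNorm (augment M b) * l2norm (augmentVec x)) := by
        rwa [cost_eq_l2norm_augment_mulVec]
    _ ≤ _ := by
        gcongr
        · exact le_ciInf hmin
        · exact mul_frobNorm_mul_l2norm_augmentVec_le_matrixAdditiveError hd hM hε hxb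

theorem exp_neg_mul_sq_le {s ε δ : ℝ} (hε : 0 < ε) (hδ : 0 < δ)
    (hs : 16 * Real.log (1 / δ) / ε ^ 2 ≤ s) : Real.exp (-(s * (ε / 4) ^ 2)) ≤ δ := by
  rw [← Real.le_log_iff_exp_le hδ, neg_le, ← Real.log_inv, ← one_div]
  rw [div_le_iff₀ (by positivity)] at hs
  linarith

theorem mul_log_inv_div_sq_le_ceil {C κ ε δ : ℝ} (hC : 0 ≤ C) (hd : 0 < d) (hκ : 1 ≤ κ)
    (hδ : 0 < δ) (hδ1 : δ ≤ 1) :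
    C * Real.log (1 / δ) / ε ^ 2 ≤ ⌈C * (d * κ ^ 2 / ε ^ 2) * Real.log (d / δ)⌉₊ := by
  have hd1 : (1 : ℝ) ≤ d := by exact_mod_cast hd
  have hlog : 0 ≤ Real.log (1 / δ) := Real.log_nonneg ((one_le_div hδ).2 hδ1)
  calc C * Real.log (1 / δ) / ε ^ 2 = C * (1 / ε ^ 2) * Real.log (1 / δ) := by ring
    _ ≤ C * (d * κ ^ 2 / ε ^ 2) * Real.log (d / δ) := by
        gcongr
        exact one_le_mul_of_one_le_of_one_le hd1 (one_le_pow₀ hκ)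
    _ ≤ _ := Nat.le_ceil _

end Sampling

/-- The function `u` is at most a constant times a power of the function `β`; with `β` the product
of the logarithmic factors, this is the `poly` and `Õ` of the space bound. -/
def PolyBounded {α : Type*} (β u : α → ℝ) : Prop :=
  ∃ a : ℕ, u =O[⊤] fun p => β p ^ a

namespace PolyBounded

variable {α : Type*} {β u v : α → ℝ}

theorem mono (hv : PolyBounded β v) (h : ∀ p, |u p| ≤ |v p|) : PolyBounded β u :=
  hv.imp fun _ ha => (Asymptotics.isBigO_of_le ⊤ h).trans ha

theorem const (r : ℝ) : PolyBounded β fun _ => r :=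
  ⟨0, by simpa only [pow_zero] using Asymptotics.isBigO_const_const r one_ne_zero ⊤⟩

theorem base : PolyBounded β β :=
  ⟨1, by simpa only [pow_one] using Asymptotics.isBigO_refl β ⊤⟩

theorem mul : PolyBounded β u → PolyBounded β v → PolyBounded β fun p => u p * v p
  | ⟨a, ha⟩, ⟨b, hb⟩ => ⟨a + b, by simpa only [pow_add] using ha.mul hb⟩

theorem pow (k : ℕ) : PolyBounded β u → PolyBounded β fun p => u p ^ k
  | ⟨a, ha⟩ => ⟨a * k, by simpa only [pow_mul] using ha.pow k⟩

theorem add (hβ : ∀ p, 1 ≤ β p) :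
    PolyBounded β u → PolyBounded β v → PolyBounded β fun p => u p + v p
  | ⟨a, ha⟩, ⟨b, hb⟩ =>
    have hpow {k : ℕ} (hk : k ≤ max a b) :
        (fun p => β p ^ k) =O[⊤] fun p => β p ^ max a b :=
      Asymptotics.isBigO_of_le ⊤ fun p => by
        simpa only [norm_pow, Real.norm_eq_abs] using
          pow_le_pow_right₀ ((hβ p).trans (le_abs_self (β p))) hk
    ⟨max a b, (ha.trans (hpow (le_max_left a b))).add (hb.trans (hpow (le_max_right a b)))⟩

theorem natCeil (hβ : ∀ p, 1 ≤ β p) (hu : PolyBounded β u) :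
    PolyBounded β fun p => (⌈u p⌉₊ : ℝ) :=
  ((hu.mono fun p => (abs_abs (u p)).le).add hβ (const 1)).mono fun p => by
    rw [Nat.abs_cast, abs_of_nonneg (by positivity)]
    calc (⌈u p⌉₊ : ℝ) ≤ ⌈|u p|⌉₊ := by gcongr; exact le_abs_self (u p)
      _ ≤ |u p| + 1 := (Nat.ceil_lt_add_one (abs_nonneg (u p))).le

theorem log_mul (hβ : ∀ p, 1 ≤ β p) (hu : PolyBounded β fun p => Real.log (u p))
    (hv : PolyBounded β fun p => Real.log (v p)) :
    PolyBounded β fun p => Real.log (u p * v p) :=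
  ((hu.mono fun p => (abs_abs (Real.log (u p))).le).add hβ
    (hv.mono fun p => (abs_abs (Real.log (v p))).le)).mono fun p => by
      rcases eq_or_ne (u p) 0 with h | hu0
      · simp [h]
      rcases eq_or_ne (v p) 0 with h | hv0
      · simp [h]
      rw [Real.log_mul hu0 hv0]
      exact (abs_add_le _ _).trans (le_abs_self _)

theorem log_pow (k : ℕ) (hu : PolyBounded β fun p => Real.log (u p)) :
    PolyBounded β fun p => Real.log (u p ^ k) := by
  simpa only [Real.log_pow] using (const (k : ℝ)).mul hu

theorem log_of_one_le (hu : PolyBounded β u) (h1 : ∀ p, 1 ≤ u p) :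
    PolyBounded β fun p => Real.log (u p) :=
  hu.mono fun p => abs_le_abs_of_nonneg (Real.log_nonneg (h1 p))
    (Real.log_le_self (zero_le_one.trans (h1 p)))

theorem logb (b : ℝ) (hu : PolyBounded β fun p => Real.log (u p)) :
    PolyBounded β fun p => Real.logb b (u p) :=
  hu.mul (const (Real.log b)⁻¹)

theorem natCast_of_two_pow {k : α → ℕ} (h : PolyBounded β fun p => (2 : ℝ) ^ k p) :
    PolyBounded β fun p => (k p : ℝ) :=
  h.mono fun p => abs_le_abs_of_nonneg (Nat.cast_nonneg _) (by
    exact_mod_cast Nat.lt_two_pow_self.le)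

theorem natClog_two (hβ : ∀ p, 1 ≤ β p) {m : α → ℕ}
    (h : PolyBounded β fun p => Real.log (m p)) :
    PolyBounded β fun p => (Nat.clog 2 (m p) : ℝ) := by
  simpa only [← Real.natCeil_logb_natCast, Nat.cast_ofNat] using (h.logb 2).natCeil hβ

end PolyBounded

theorem two_pow_clog_le (m : ℕ) : 2 ^ Nat.clog 2 m ≤ 2 * m + 1 := by
  rcases Nat.lt_or_ge 1 m with h | h
  · obtain ⟨k, hk⟩ := Nat.exists_eq_succ_of_ne_zero (Nat.clog_pos one_lt_two h).ne'
    have hlt := Nat.pow_pred_clog_lt_self one_lt_two h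
    rw [hk, Nat.pred_succ] at hlt
    rw [hk, pow_succ]
    omega
  · rw [Nat.clog_of_right_le_one h, pow_zero]
    exact Nat.le_add_left 1 _

theorem PolyBounded.two_pow_logBuckets {α : Type*} {β φ : α → ℝ} (hβ : ∀ p, 1 ≤ β p)
    (c : SketchConst) (hφ : PolyBounded β fun p => (φ p)⁻¹) :
    PolyBounded β fun p => (2 : ℝ) ^ logBuckets c (φ p) := by
  have hwidth : PolyBounded β fun p => c.width / (φ p ^ 2 * c.nu ^ 3) :=
    ((const (c.width / c.nu ^ 3)).mul (hφ.pow 2)).mono fun p => le_of_eq (by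
      congr 1
      ring)
  refine (((const 2).mul (hwidth.natCeil hβ)).add hβ (const 1)).mono fun p => ?_
  refine abs_le_abs_of_nonneg (by positivity) ?_
  exact_mod_cast two_pow_clog_le _

/-- The data on which the space depends, for at most as many samples as the theorem takes with the
constant `C`. -/
structure SpaceParams (C : ℝ) where
  n : ℕ
  d : ℕ
  s : ℕ
  κ : ℝ
  ε : ℝ
  δ : ℝ
  n_pos : 0 < n
  d_pos : 0 < d
  one_le_κ : 1 ≤ κ
  ε_pos : 0 < ε
  ε_le_one : ε ≤ 1
  δ_pos : 0 < δ
  s_le : s ≤ ⌈C * (d * κ ^ 2 / ε ^ 2) * Real.log (d / δ)⌉₊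

namespace SpaceParams

variable {C : ℝ} (p : SpaceParams C)

/-- The main term `X = d² κ² max {1, log (1 / δ)}` of the space bound. -/
noncomputable def mainTerm : ℝ := p.d ^ 2 * p.κ ^ 2 * max 1 (Real.log (1 / p.δ))

/-- The product of the logarithmic factors and of `1 / ε`, whose powers are the lower order factors
of the space bound. -/
noncomputable def base : ℝ := Real.log (2 + p.mainTerm) * (Real.log (2 + p.n) / p.ε)

theorem one_le_d : (1 : ℝ) ≤ p.d := by exact_mod_cast p.d_pos

theorem one_le_n : (1 : ℝ) ≤ p.n := by exact_mod_cast p.n_pos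

theorem d_le_mainTerm : (p.d : ℝ) ≤ p.mainTerm := by
  have hκ : 1 ≤ p.κ ^ 2 := one_le_pow₀ p.one_le_κ
  calc (p.d : ℝ) ≤ p.d ^ 2 * 1 * 1 := by
        simpa only [mul_one] using le_self_pow₀ p.one_le_d two_ne_zero
    _ ≤ p.mainTerm := by
        unfold mainTerm
        gcongr
        exact le_max_left _ _

theorem one_le_mainTerm : 1 ≤ p.mainTerm := p.one_le_d.trans p.d_le_mainTerm

theorem one_le_log_two_add {x : ℝ} (hx : 1 ≤ x) : 1 ≤ Real.log (2 + x) := by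
  rw [Real.le_log_iff_exp_le (by linarith)]
  linarith [Real.exp_one_lt_d9]

theorem one_le_log_mainTerm : 1 ≤ Real.log (2 + p.mainTerm) := one_le_log_two_add p.one_le_mainTerm

theorem one_le_log_n : 1 ≤ Real.log (2 + p.n) := one_le_log_two_add p.one_le_n

theorem one_le_inv_ε : 1 ≤ p.ε⁻¹ := (one_le_inv₀ p.ε_pos).2 p.ε_le_one

theorem log_mainTerm_mul_inv_ε_le_base : Real.log (2 + p.mainTerm) * p.ε⁻¹ ≤ p.base := by
  have hL := p.one_le_log_mainTerm
  have hε := p.one_le_inv_ε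
  rw [base, div_eq_mul_inv]
  gcongr
  exact le_mul_of_one_le_left (by positivity) p.one_le_log_n

theorem log_mainTerm_le_base : Real.log (2 + p.mainTerm) ≤ p.base :=
  (le_mul_of_one_le_right (zero_le_one.trans p.one_le_log_mainTerm) p.one_le_inv_ε).trans
    p.log_mainTerm_mul_inv_ε_le_base

theorem inv_ε_le_base : p.ε⁻¹ ≤ p.base :=
  (le_mul_of_one_le_left (zero_le_one.trans p.one_le_inv_ε) p.one_le_log_mainTerm).trans
    p.log_mainTerm_mul_inv_ε_le_base

theorem one_le_base : 1 ≤ p.base := p.one_le_log_mainTerm.trans p.log_mainTerm_le_base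

theorem log_n_le_base : Real.log (2 + p.n) ≤ p.base := by
  have hn := p.one_le_log_n
  calc Real.log (2 + p.n) ≤ Real.log (2 + p.n) / p.ε :=
        le_div_self (by positivity) p.ε_pos p.ε_le_one
    _ ≤ p.base :=
        le_mul_of_one_le_left (div_nonneg (by positivity) p.ε_pos.le) p.one_le_log_mainTerm

theorem log_div_le :
    Real.log (p.d / p.δ) ≤ 2 * (Real.log (2 + p.mainTerm) * max 1 (Real.log (1 / p.δ))) := by
  have hL := p.one_le_log_mainTerm
  have hm : 1 ≤ max 1 (Real.log (1 / p.δ)) := le_max_left _ _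
  have hd : Real.log p.d ≤ Real.log (2 + p.mainTerm) :=
    Real.log_le_log (by exact_mod_cast p.d_pos) (by linarith [p.d_le_mainTerm])
  calc Real.log (p.d / p.δ) = Real.log p.d + Real.log (1 / p.δ) := by
        rw [div_eq_mul_one_div,
          Real.log_mul (by exact_mod_cast p.d_pos.ne') (one_div_pos.2 p.δ_pos).ne']
    _ ≤ Real.log (2 + p.mainTerm) + max 1 (Real.log (1 / p.δ)) := add_le_add hd (le_max_right _ _)
    _ ≤ Real.log (2 + p.mainTerm) * max 1 (Real.log (1 / p.δ)) +
          Real.log (2 + p.mainTerm) * max 1 (Real.log (1 / p.δ)) :=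
        add_le_add (le_mul_of_one_le_right (by linarith) hm)
          (le_mul_of_one_le_left (by linarith) hL)
    _ = _ := (two_mul _).symm

theorem succ_s_mul_succ_d_le (hC : 0 ≤ C) :
    ((p.s : ℝ) + 1) * (p.d + 1) ≤ (4 * C + 4) * (p.mainTerm * p.base ^ 2) := by
  have hd := p.one_le_d
  have hL := p.one_le_log_mainTerm
  have hX := p.one_le_mainTerm
  set m := max 1 (Real.log (1 / p.δ)) with hm
  have hs : (p.s : ℝ) ≤ C * (p.d * p.κ ^ 2 / p.ε ^ 2) * (2 * (Real.log (2 + p.mainTerm) * m)) + 1 :=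
    calc (p.s : ℝ) ≤ ⌈C * (p.d * p.κ ^ 2 / p.ε ^ 2) * (2 * (Real.log (2 + p.mainTerm) * m))⌉₊ := by
          refine Nat.cast_le.2 (p.s_le.trans (Nat.ceil_le_ceil ?_))
          gcongr
          exact p.log_div_le
      _ ≤ _ := (Nat.ceil_lt_add_one (by positivity)).le
  have hbase : Real.log (2 + p.mainTerm) * p.ε⁻¹ ^ 2 ≤ p.base ^ 2 :=
    calc Real.log (2 + p.mainTerm) * p.ε⁻¹ ^ 2 ≤ Real.log (2 + p.mainTerm) ^ 2 * p.ε⁻¹ ^ 2 := by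
          gcongr
          exact le_self_pow₀ hL two_ne_zero
      _ = (Real.log (2 + p.mainTerm) * p.ε⁻¹) ^ 2 := (mul_pow _ _ _).symm
      _ ≤ p.base ^ 2 := by
          have := p.one_le_inv_ε
          gcongr
          exact p.log_mainTerm_mul_inv_ε_le_base
  have hdX : (p.d : ℝ) ≤ p.mainTerm * p.base ^ 2 :=
    p.d_le_mainTerm.trans (le_mul_of_one_le_right (by linarith) (one_le_pow₀ p.one_le_base))
  calc ((p.s : ℝ) + 1) * (p.d + 1)
      ≤ (C * (p.d * p.κ ^ 2 / p.ε ^ 2) * (2 * (Real.log (2 + p.mainTerm) * m)) + 1 + 1) *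
          (p.d + p.d) := by gcongr
    _ = 4 * C * (p.d ^ 2 * p.κ ^ 2 * m * (Real.log (2 + p.mainTerm) * p.ε⁻¹ ^ 2)) + 4 * p.d := by
        ring
    _ ≤ 4 * C * (p.mainTerm * p.base ^ 2) + 4 * (p.mainTerm * p.base ^ 2) := by
        rw [hm, ← mainTerm]
        gcongr
    _ = _ := by ring

end SpaceParams

namespace PolyBounded

variable {C : ℝ}

theorem inv_ε : PolyBounded SpaceParams.base fun p : SpaceParams C => p.ε⁻¹ :=
  base.mono fun p => abs_le_abs_of_nonneg (inv_nonneg.2 p.ε_pos.le) p.inv_ε_le_base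

theorem log_n : PolyBounded SpaceParams.base fun p : SpaceParams C => Real.log p.n :=
  base.mono fun p => abs_le_abs_of_nonneg (Real.log_nonneg p.one_le_n)
    ((Real.log_le_log (by linarith [p.one_le_n]) (by linarith)).trans p.log_n_le_base)

theorem log_mainTerm : PolyBounded SpaceParams.base fun p : SpaceParams C => Real.log p.mainTerm :=
  base.mono fun p => abs_le_abs_of_nonneg (Real.log_nonneg p.one_le_mainTerm)
    ((Real.log_le_log (by linarith [p.one_le_mainTerm]) (by linarith)).trans p.log_mainTerm_le_base)

theorem log_s (hC : 0 ≤ C) :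
    PolyBounded SpaceParams.base fun p : SpaceParams C => Real.log p.s := by
  have hbound : PolyBounded SpaceParams.base fun p : SpaceParams C =>
      Real.log ((4 * C + 4) * (p.mainTerm * p.base ^ 2)) :=
    (const _).log_mul SpaceParams.one_le_base (log_mainTerm.log_mul SpaceParams.one_le_base
      ((base.log_of_one_le SpaceParams.one_le_base).log_pow 2))
  refine hbound.mono fun p => ?_
  rcases Nat.eq_zero_or_pos p.s with hs | hs
  · simp [hs]
  have hs1 : (1 : ℝ) ≤ p.s := by exact_mod_cast hs
  refine abs_le_abs_of_nonneg (Real.log_nonneg hs1) (Real.log_le_log (by linarith) ?_)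
  calc (p.s : ℝ) ≤ (p.s + 1) * (p.d + 1) := by nlinarith [p.one_le_d]
    _ ≤ _ := p.succ_s_mul_succ_d_le hC

variable (c : SketchConst)

theorem levels : PolyBounded SpaceParams.base
    fun p : SpaceParams C => ((c.size p.n p.s p.ε).levels : ℝ) := by
  have hβ := SpaceParams.one_le_base (C := C)
  have hlog := ((const (Real.log c.K)).log_mul hβ log_n).log_mul hβ
    ((const (Real.log c.acc⁻¹)).log_mul hβ (inv_ε.log_of_one_le SpaceParams.one_le_inv_ε))
  simp_rw [← mul_inv, ← div_eq_mul_inv] at hlog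
  exact (hlog.logb 2).natCeil hβ

theorem rates : PolyBounded SpaceParams.base
    fun p : SpaceParams C => ((c.size p.n p.s p.ε).rates : ℝ) :=
  log_n.natClog_two SpaceParams.one_le_base

theorem reps (hC : 0 ≤ C) : PolyBounded SpaceParams.base
    fun p : SpaceParams C => ((c.size p.n p.s p.ε).reps : ℝ) := by
  have hβ := SpaceParams.one_le_base (C := C)
  have hrates : PolyBounded SpaceParams.base fun p : SpaceParams C => (Nat.clog 2 p.n : ℝ) + 1 :=
    (rates c).add hβ (const 1)
  have hlog := log_n.log_mul hβ
    ((hrates.log_of_one_le fun p => le_add_of_nonneg_left (Nat.cast_nonneg _)).log_mul hβ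
      (log_s hC))
  simpa only [SketchConst.size, Nat.cast_add_one] using
    (((const c.rep).mul (hlog.logb 2)).natCeil hβ).add hβ (const 1)

theorem levels_pow_div_ε_pow : PolyBounded SpaceParams.base
    fun p : SpaceParams C => ((c.size p.n p.s p.ε).levels : ℝ) ^ 3 / (c.acc * p.ε) ^ 3 :=
  (((levels c).pow 3).mul ((const (c.acc⁻¹ ^ 3)).mul (inv_ε.pow 3))).mono fun p => le_of_eq (by
    congr 1
    ring)

theorem top : PolyBounded SpaceParams.base
    fun p : SpaceParams C => ((c.size p.n p.s p.ε).top : ℝ) := by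
  simpa only [SketchConst.size, mul_div_assoc] using
    ((const c.top).mul (levels_pow_div_ε_pow c)).natCeil SpaceParams.one_le_base

theorem two_pow_logWidthZero : PolyBounded SpaceParams.base
    fun p : SpaceParams C => (2 : ℝ) ^ (c.size p.n p.s p.ε).logWidthZero :=
  two_pow_logBuckets SpaceParams.one_le_base c
    (((const (c.K / c.phi)).mul (levels_pow_div_ε_pow c)).mono fun p => le_of_eq (by
      congr 1
      rw [inv_div, div_mul_div_comm]
      rfl))

theorem two_pow_logWidthSub : PolyBounded SpaceParams.base
    fun p : SpaceParams C => (2 : ℝ) ^ (c.size p.n p.s p.ε).logWidthSub :=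
  two_pow_logBuckets SpaceParams.one_le_base c
    (((const c.phi⁻¹).mul (levels_pow_div_ε_pow c)).mono fun p => le_of_eq (by
      congr 1
      rw [inv_div, ← div_div, inv_mul_eq_div, div_right_comm]
      rfl))

theorem wordBits : PolyBounded SpaceParams.base
    fun p : SpaceParams C => ((c.size p.n p.s p.ε).wordBits : ℝ) := by
  have hβ := SpaceParams.one_le_base (C := C)
  simpa only [SketchSize.wordBits, Nat.cast_add, Nat.cast_one] using
    (((rates c).add hβ (two_pow_logWidthZero c).natCast_of_two_pow).add hβ
      (two_pow_logWidthSub c).natCast_of_two_pow).add hβ (const 1)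

end PolyBounded

/-- An upper bound, free of `d` and `s`, for the space that the sketch needs for each of the `d + 1`
columns of each instance; the last summand also accounts for `T` and `x̃`. -/
def spacePerColumn (P : SketchSize) : ℕ :=
  (P.rates + 1) * (P.reps * (2 ^ P.logWidthZero + 2 ^ P.logWidthSub)) + seedBits P
    + (P.rates + 1) * P.top * 2 + P.levels * 2 + 9

theorem card_tableCell_le (P : SketchSize) (d : ℕ) : Fintype.card (TableCell P d) ≤
    (P.rates + 1) * (P.reps * (2 ^ P.logWidthZero + 2 ^ P.logWidthSub)) * (d + 1) := by
  have hwidth (ℓ : ℕ) : P.width ℓ ≤ 2 ^ P.logWidthZero + 2 ^ P.logWidthSub := by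
    unfold SketchSize.width SketchSize.logWidth
    split_ifs
    · exact Nat.le_add_right _ _
    · exact Nat.le_add_left _ _
  calc Fintype.card (TableCell P d)
      = ∑ ℓ : Fin (P.rates + 1), P.reps * (P.width ℓ * (d + 1)) := by
        simp only [TableCell, Fintype.card_sigma, Fintype.card_prod, Fintype.card_fin]
    _ ≤ ∑ _ℓ : Fin (P.rates + 1),
          P.reps * ((2 ^ P.logWidthZero + 2 ^ P.logWidthSub) * (d + 1)) := by
        gcongr
        exact hwidth _
    _ = _ := by simp [mul_assoc]

theorem totalSpace_le (P : SketchSize) (d s : ℕ) :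
    totalSpace P d s ≤ (s + 1) * (d + 1) * spacePerColumn P := by
  have hinstance : instanceSpace P d + (d + 1) ≤ (d + 1) * spacePerColumn P := by
    have hcells := card_tableCell_le P d
    unfold instanceSpace spacePerColumn
    generalize (P.rates + 1) * (P.reps * (2 ^ P.logWidthZero + 2 ^ P.logWidthSub)) = cells at *
    generalize seedBits P = bits
    generalize (P.rates + 1) * P.top * 2 = heavy
    nlinarith [Nat.zero_le (d * bits), Nat.zero_le (d * heavy), Nat.zero_le (d * P.levels)]
  calc totalSpace P d s = s * (instanceSpace P d + (d + 1)) + d := by unfold totalSpace; ring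
    _ ≤ s * ((d + 1) * spacePerColumn P) + (d + 1) * spacePerColumn P :=
        add_le_add (Nat.mul_le_mul_left s hinstance)
          ((Nat.le_succ d).trans ((Nat.le_add_left _ _).trans hinstance))
    _ = _ := by ring

theorem PolyBounded.spacePerColumn {C : ℝ} (hC : 0 ≤ C) (c : SketchConst) :
    PolyBounded SpaceParams.base
      fun p : SpaceParams C => (RegSketch.spacePerColumn (c.size p.n p.s p.ε) : ℝ) := by
  have hβ := SpaceParams.one_le_base (C := C)
  have hrates := (rates c).add hβ (const 1)
  have hwidth := (two_pow_logWidthZero c).add hβ (two_pow_logWidthSub c)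
  have hseed := (((hrates.mul (reps c hC)).mul (const (2 + 4))).add hβ
    (hrates.mul (const 2))).mul (wordBits c)
  simpa only [RegSketch.spacePerColumn, seedBits, Nat.cast_add, Nat.cast_mul, Nat.cast_pow,
    Nat.cast_ofNat, Nat.cast_one] using
    ((((hrates.mul ((reps c hC).mul hwidth)).add hβ hseed).add hβ
      ((hrates.mul (top c)).mul (const 2))).add hβ ((levels c).mul (const 2))).add hβ (const 9)

theorem exists_totalSpace_le {C : ℝ} (hC : 0 ≤ C) (c : SketchConst) :
    ∃ B > (0 : ℝ), ∃ a : ℕ, ∀ p : SpaceParams C,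
      (totalSpace (c.size p.n p.s p.ε) p.d p.s : ℝ) ≤
        B * p.mainTerm * Real.log (2 + p.mainTerm) ^ a * (Real.log (2 + p.n) / p.ε) ^ a := by
  obtain ⟨a, ha⟩ := PolyBounded.spacePerColumn hC c
  obtain ⟨B, hB, hspace⟩ := ha.exists_pos
  refine ⟨(4 * C + 4) * B, by positivity, 2 + a, fun p => ?_⟩
  have hβ := p.one_le_base
  have hX := p.one_le_mainTerm
  have hcolumn : (spacePerColumn (c.size p.n p.s p.ε) : ℝ) ≤ B * p.base ^ a := by
    simpa [abs_of_nonneg (zero_le_one.trans hβ)] using Asymptotics.isBigOWith_top.1 hspace p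
  calc (totalSpace (c.size p.n p.s p.ε) p.d p.s : ℝ)
      ≤ ((p.s : ℝ) + 1) * (p.d + 1) * spacePerColumn (c.size p.n p.s p.ε) := by
        exact_mod_cast totalSpace_le _ p.d p.s
    _ ≤ (4 * C + 4) * (p.mainTerm * p.base ^ 2) * (B * p.base ^ a) :=
        mul_le_mul (p.succ_s_mul_succ_d_le hC) hcolumn (Nat.cast_nonneg _) (by positivity)
    _ = _ := by rw [SpaceParams.base]; ring

end RegSketch

theorem mainTheorem6_general (c : SketchConst) {C : ℝ} (hC : 0 ≤ C) :
    ∃ B > (0 : ℝ), ∃ a : ℕ,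
    ∀ (n d : ℕ) (M : Matrix (Fin n) (Fin d) ℝ) (b : Fin n → ℝ) (ε δ : ℝ),
      0 < d → M.rank = d → 0 < ε → ε ≤ 1 → 0 < δ →
    ∀ s : ℕ,
      (16 * Real.log (1 / δ) / ε ^ 2 ≤ s →
        ∀ (Ω : Type u) [MeasurableSpace Ω] (μ : Measure Ω) [IsProbabilityMeasure μ]
          (h : Fin s → Ω → RowSample n d),
          GoodSampling μ (1 / 4 * ε) (augment M b) h →
          μ {ω | ¬ MatrixRegressionGuarantee M b ε fun t => h t ω} ≤ ENNReal.ofReal δ) ∧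
      (s ≤ ⌈C * (d * condNumber M ^ 2 / ε ^ 2) * Real.log (d / δ)⌉₊ →
        ∀ X : ℝ, X = d ^ 2 * condNumber M ^ 2 * max 1 (Real.log (1 / δ)) →
          (totalSpace (c.size n s ε) d s : ℝ) ≤
            B * X * Real.log (2 + X) ^ a * (Real.log (2 + n) / ε) ^ a) := by
  obtain ⟨B, hB, a, hspace⟩ := exists_totalSpace_le hC c
  refine ⟨B, hB, a, fun n d M b ε δ hd hM hε hε1 hδ s => ⟨fun hs Ω _ μ _ h H => ?_, ?_⟩⟩
  · rw [one_div_mul_eq_div] at H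
    exact (H.measure_not_matrixRegressionGuarantee_le hd hM hε.le hε1).trans
      (ENNReal.ofReal_le_ofReal (exp_neg_mul_sq_le hε hδ hs))
  · rintro hs X rfl
    have hn : 0 < n := hd.trans_le (hM ▸ M.rank_le_height)
    exact hspace ⟨n, d, s, condNumber M, ε, δ, hn, hd, one_le_condNumber hd hM, hε, hε1, hδ, hs⟩

theorem mainTheorem6 :
    -- absolute constants: the quality `γ * ε` of the samples and the constant in `s`
    ∃ γ > (0 : ℝ), ∃ C > (0 : ℝ),
    -- for any choice of the constants in the sizes of the sketch
    ∀ c : SketchConst, ∃ B > (0 : ℝ), ∃ a : ℕ,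
    ∀ (n d : ℕ) (A : Matrix (Fin n) (Fin d) ℝ) (b : Fin n → ℝ) (ε δ : ℝ),
      0 < d → (logMatrix A).rank = d → 0 < ε → ε < 1 → 0 < δ → δ < 1 →
    ∀ s : ℕ,
      s = ⌈C * (d * condNumber (logMatrix A) ^ 2 / ε ^ 2) * Real.log (d / δ)⌉₊ →
      -- error bound for any good noisy row samples of `(f(A)  b)`
      (∀ (Ω : Type u) [MeasurableSpace Ω] (μ : Measure Ω) [IsProbabilityMeasure μ]
          (h : Fin s → Ω → RowSample n d),
          GoodSampling μ (γ * ε) (augment (logMatrix A) b) h →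
          μ {ω | ¬ RegressionGuarantee A b ε fun t => h t ω} ≤ ENNReal.ofReal δ) ∧
      -- the same for the one-pass streaming algorithm, whose samples come from the sketch;
      -- `μ` is any law of its randomness under which all samples are good, such as the
      -- uniform law conditioned on that event
      (∀ (S : List (Update n (d + 1))), streamMatrix S = augment A b →
        ∀ (Ω : Type u) [MeasurableSpace Ω] (μ : Measure Ω) [IsProbabilityMeasure μ]
          (ρ : Fin s → Ω → Randomness (c.size n s ε)) (Mhat : Fin s → Ω → ℝ)
          (h : Fin s → Ω → RowSample n d),
          (∀ᵐ ω ∂μ, ∀ t,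
            (ρ t ω).sample n (sketchStream (ρ t ω) S) (Mhat t ω) = some (h t ω)) →
          GoodSampling μ (γ * ε) (augment (logMatrix A) b) h →
          μ {ω | ¬ RegressionGuarantee A b ε fun t => h t ω} ≤ ENNReal.ofReal δ) ∧
      -- space `Õ(d² κ² log(1/δ)) * poly(log n, 1/ε)`
      (∀ X : ℝ, X = d ^ 2 * condNumber (logMatrix A) ^ 2 * max 1 (Real.log (1 / δ)) →
        (totalSpace (c.size n s ε) d s : ℝ) ≤
          B * X * Real.log (2 + X) ^ a * (Real.log (2 + n) / ε) ^ a) := by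
  refine ⟨1 / 4, by norm_num, 16, by norm_num, fun c => ?_⟩
  obtain ⟨B, hB, a, hgeneral⟩ := mainTheorem6_general.{u} c (C := 16) (by norm_num)
  refine ⟨B, hB, a, fun n d A b ε δ hd hA hε hε1 hδ hδ1 s hs => ?_⟩
  obtain ⟨herror, hspace⟩ := hgeneral n d (logMatrix A) b ε δ hd hA hε hε1.le hδ s
  have hguarantee := herror
    (hs ▸ mul_log_inv_div_sq_le_ceil (by norm_num) hd (one_le_condNumber hd hA) hδ hδ1.le)
  exact ⟨hguarantee, fun _ _ Ω _ μ _ _ _ h _ => hguarantee Ω μ h, hspace hs.le⟩
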